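/- Fix an integer $\bar m\ge 1$ and $r\in(0,2)$. For each sample size $n$ let $p=p(n)$, let $\lambda_1\ge\dots\ge\lambda_{\bar m}>0$ (depending on $n$), put $\lambda_{\bar m+1}^2=0$, let $q_1,\dots,q_{\bar m}\in\mathbb R^p$ be orthonormal, and let $x_1,\dots,x_n$ be i.i.d. $N_p(0,\Sigma)$ with $\Sigma=\sum_{j=1}^{\bar m}\lambda_j^2q_jq_j'+I$ (samples of different sizes are defined on one probability space, with arbitrary joint dependence). Put $p_n=\max(p,n)$. Suppose $q_j$ lies in the weak-$\ell_r$ ball of radius $s_j=s_j(n)$, i.e. its $\nu$-th largest absolute coordinate is at most $s_j\nu^{-1/r}$ for all $\nu$. Assume the following as $n\to\infty$. Condition GR: (1) $(\log p)/n=o(1)$; (2) $\lambda_1^2=O(p_n)$, $\log p_n=o(n\lambda_{\bar m}^4)$ and $\lambda_1^2/\lambda_{\bar m}^2=O\big(n[\log(p_n)/n]^{1/2+r/4}\big)$; (3) $\lim_{n\to\infty}\lambda_1^2/(\lambda_j^2-\lambda_{j+1}^2)\in[1,\infty]$ exists for $j=1,\dots,\bar m$. Condition SP: $s_j\ge1$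 and $s_j^r\big[\log(p_n)/(n\lambda_j^4)\big]^{1/2-r/4}=o(\min(1,\lambda_1^4))$ for $j=1,\dots,\bar m$. Let $S=\frac1n\sum_{i=1}^n x_ix_i'$, let $\alpha>2\sqrt3$ be a constant, and let $B=\{\nu: S_{\nu\nu}\ge 1+\alpha[\log(p_n)/n]^{1/2}\}$. Let $\ell_j^B$ be the maximum of $1$ and the $j$-th largest eigenvalue of the submatrix $S_{BB}$ (so $\ell_j^B=1$ if $j>\operatorname{card}(B)$). Then for each $1\le j\le\bar m$: if $\lim_{n\to\infty}\lambda_1^2/(\lambda_j^2-\lambda_{j+1}^2)<\infty$, then $$\lim_{n\to\infty}\frac{(\ell_1^B-1)/(\ell_j^B-\ell_{j+1}^B)}{\lambda_1^2/(\lambda_j^2-\lambda_{j+1}^2)}=1\quad\text{a.s.};$$ otherwise $\lim_{n\to\infty}(\ell_1^B-1)/(\ell_j^B-\ell_{j+1}^B)=\lim_{n\to\infty}\lambda_1^2/(\lambda_j^2-\lambda_{j+1}^2)=\infty$ a.s., where $c/0=\infty$ for $c>0$. If, further, condition $\mathrm{AD}(m,\kappa)$ holds for some $1\le m\le\bar m$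 and $\kappa>0$, i.e. $\lambda_m^2-\lambda_{m+1}^2\ge\lambda_1^2/\kappa$ for all sufficiently large $n$, then $\lim_{n\to\infty}(\ell_j^B-1)/\lambda_j^2=1$ a.s. for $1\le j\le m$. -/

import Mathlib

open Filter Topology MeasureTheory ProbabilityTheory Asymptotics
open scoped ENNReal

noncomputable section

namespace SparsePCA

/-- The `ν`-th largest absolute value among the coordinates of `u`
(`ν = 0` is the largest one). -/
def absOrdered {p : ℕ} (u : EuclideanSpace ℝ (Fin p)) (ν : Fin p) : ℝ :=
  |u (Tuple.sort (fun i => -|u i|) ν)|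

/-- `u` lies in the weak-`ℓ_r` ball of radius `s`: the `k`-th largest absolute coordinate is at
most `s * k ^ (-1/r)` for `k = 1, …, p`. -/
def WeakLr (r s : ℝ) {p : ℕ} (u : EuclideanSpace ℝ (Fin p)) : Prop :=
  ∀ ν : Fin p, absOrdered u ν ≤ s * ((ν : ℝ) + 1) ^ (-1 / r)

/-- A sequence (indexed by the sample size `n`) of spiked covariance models with unit noise
level and a fixed number `mbar` of spikes: dimension `p n`, spikes `λ_j² = (lam n j)²`,
and orthonormal leading eigenvectors `q n j`. The index `j : Fin mbar` starts at `0`. -/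
structure SpikedModel (mbar : ℕ) where
  p : ℕ → ℕ
  lam : ℕ → Fin mbar → ℝ
  q : (n : ℕ) → Fin mbar → EuclideanSpace ℝ (Fin (p n))
  lam_pos : ∀ n j, 0 < lam n j
  lam_antitone : ∀ n, Antitone (lam n)
  orthonormal : ∀ n, Orthonormal ℝ (q n)

namespace SpikedModel

variable {mbar : ℕ} (M : SpikedModel mbar)

/-- The covariance matrix `∑_j λ_j² q_j q_jᵀ + I`. -/
def cov (n : ℕ) : Matrix (Fin (M.p n)) (Fin (M.p n)) ℝ :=
  (∑ j, (M.lam n j) ^ 2 • Matrix.vecMulVec (M.q n j) (M.q n j)) + 1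

/-- The spike `λ_j²` for `j = 1, …, mbar` (numbered from `1`), and `0` for `j = mbar + 1`. -/
def spike (n j : ℕ) : ℝ :=
  if h : 1 ≤ j ∧ j ≤ mbar then (M.lam n ⟨j - 1, by omega⟩) ^ 2 else 0

/-- `p_n = max p n`. -/
def pmax (n : ℕ) : ℝ := ((max (M.p n) n : ℕ) : ℝ)

/-- `λ_1² / (λ_j² - λ_{j+1}²)`, with values in `[0, ∞]` (it is `∞` if `λ_j² = λ_{j+1}²`). -/
def spikeRatio (j n : ℕ) : ℝ≥0∞ :=
  ENNReal.ofReal (M.spike n 1) / ENNReal.ofReal (M.spike n j - M.spike n (j + 1))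

/-- The growth rate condition GR. -/
structure GR (r : ℝ) : Prop where
  dim : (fun n => Real.log (M.p n) / n) =o[atTop] (fun _ => (1 : ℝ))
  largest : (fun n => M.spike n 1) =O[atTop] M.pmax
  smallest : (fun n => Real.log (M.pmax n)) =o[atTop] (fun n => (n : ℝ) * M.spike n mbar ^ 2)
  ratio : (fun n => M.spike n 1 / M.spike n mbar) =O[atTop]
    (fun n => (n : ℝ) * (Real.log (M.pmax n) / n) ^ (1 / 2 + r / 4))
  limit : ∀ j, 1 ≤ j → j ≤ mbar →
    ∃ L : ℝ≥0∞, 1 ≤ L ∧ Tendsto (M.spikeRatio j) atTop (𝓝 L)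

/-- The sparsity condition SP; `s n j` is the weak-`ℓ_r` radius attached to `q n j`. -/
structure SP (r : ℝ) (s : ℕ → Fin mbar → ℝ) : Prop where
  one_le : ∀ n j, 1 ≤ s n j
  rate : ∀ j, (fun n => s n j ^ r *
      (Real.log (M.pmax n) / (n * M.lam n j ^ 4)) ^ (1 / 2 - r / 4))
    =o[atTop] (fun n => min 1 (M.spike n 1 ^ 2))

/-- The asymptotic distinguishability condition AD(m, κ). -/
def AD (m : ℕ) (κ : ℝ) : Prop :=
  ∀ᶠ n in atTop, M.spike n 1 / κ ≤ M.spike n m - M.spike n (m + 1)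

/-- For every `n`, the random vectors `X n i`, `i < n`, are i.i.d. `N_p(0, Σ_n)`. Nothing is
assumed on the dependence between samples of different sizes. -/
def IsSample {Ω : Type*} [MeasurableSpace Ω] (P : Measure Ω)
    (X : (n : ℕ) → Fin n → Ω → EuclideanSpace ℝ (Fin (M.p n))) : Prop :=
  ∀ n, (∀ i, HasLaw (X n i) (multivariateGaussian 0 (M.cov n)) P) ∧ iIndepFun (X n) P

end SpikedModel

/-- The sample covariance matrix `S = n⁻¹ ∑_i x_i x_iᵀ`. -/
def sampleCov {n p : ℕ} (x : Fin n → EuclideanSpace ℝ (Fin p)) : Matrix (Fin p) (Fin p) ℝ :=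
  (n : ℝ)⁻¹ • ∑ i, Matrix.vecMulVec (x i) (x i)

/-- The `j`-th largest eigenvalue (numbered from `1`, with multiplicity) of a real symmetric
matrix; the value is `0` if `j` is not between `1` and the size of the matrix. -/
def eval {ι : Type*} [Fintype ι] [DecidableEq ι] (A : Matrix ι ι ℝ) (j : ℕ) : ℝ :=
  open Classical in
  if h : A.IsHermitian ∧ 1 ≤ j ∧ j ≤ Fintype.card ι then
    h.1.eigenvalues₀ ⟨j - 1, by omega⟩
  else 0

/-- The selected coordinates `B = {ν : s_νν ≥ 1 + α_n}`, `α_n = α (log (max p n) / n)^(1/2)`. -/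
def selected (α : ℝ) {n p : ℕ} (x : Fin n → EuclideanSpace ℝ (Fin p)) : Finset (Fin p) :=
  open Classical in
  Finset.univ.filter fun ν =>
    1 + α * Real.sqrt (Real.log ((max p n : ℕ) : ℝ) / n) ≤ sampleCov x ν ν

/-- `ℓ_j^B = max (ℓ_j(S_BB)) 1`; it is `1` if `j > card B`. -/
def ellB (α : ℝ) {n p : ℕ} (x : Fin n → EuclideanSpace ℝ (Fin p)) (j : ℕ) : ℝ :=
  max (eval ((sampleCov x).submatrix
    (Subtype.val : {ν // ν ∈ selected α x} → Fin p) Subtype.val) j) 1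

end SparsePCA

end

/-! A single estimate carries the theorem: almost surely, for all large `n` and all
`1 ≤ j ≤ mbar + 1`, the error `|ℓ_j^B - 1 - λ_j²|` is at most `R n * λ_1²` with a deterministic
`R n → 0` (`SpikedModel.IsSample.exists_rate`). The ratios of spacings are compared on the scale
`λ_1²`, so the three limits follow by elementary arithmetic; in the first one the spacing
`λ_j² - λ_{j+1}²` is itself of order `λ_1²`, and under `AD` so are the first `m` spikes.

Write `τ = √(log p_n / n)`, which tends to `0`, and `Σ` for the covariance matrix. A Chernoff bound
for `χ²` variables, a union bound and the Borel–Cantelli lemma control the quadratic form of the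
sample covariance `S` at polynomially many vectors. This gives
`|S_νν - Σ_νν| ≤ 2√3 τ Σ_νν` and, by polarization, `|S_νμ - Σ_νμ| ≤ 8 τ √(Σ_νν Σ_μμ)` for all
entries. The second bound makes the error of the quadratic form on vectors supported in `B` at most
`8 τ ∑_{ν ∈ B} Σ_νν ≤ 8 τ (card B + mbar λ_1²)`; no bound on the operator norm of a random matrix is
needed, even when `λ_1` is large.

Since `α > 2√3`, the diagonal bound shows that a selected coordinate satisfies `Σ_νν - 1 ≥ c τ` and
a discarded one `Σ_νν - 1 ≤ C τ`. For vectors in weak-`ℓ_r` balls this means that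
`τ card B = O(λ_1² ∑_j ρ_j)` and that `q_j` has squared mass `O(ρ_j + τ / λ_j²)` outside `B`, where
`ρ_j = s_j ^ r (τ / λ_j²) ^ (1 - r / 2)` tends to `0` by the sparsity condition. The min-max
principle then bounds the eigenvalues of `S_BB`: from above on the orthogonal complement of
`q_1, …, q_{j-1}`, from below on the span of the truncations of `q_1, …, q_j` to `B`. -/

namespace SparsePCA

/-! ### Vectors in weak-`ℓ_r` balls -/

/-- A vector in the weak-`ℓ_r` ball of radius `s` has at most `(s / a) ^ r` coordinates of absolute
value at least `a`. -/
lemma WeakLr.card_le {r s : ℝ} {p : ℕ} {u : EuclideanSpace ℝ (Fin p)} (hu : WeakLr r s u)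
    (hr : 0 < r) {a : ℝ} (ha : 0 < a) (hs : 0 ≤ s) :
    ((Finset.univ.filter fun ν => a ≤ |u ν|).card : ℝ) ≤ (s / a) ^ r := by
  set σ := Tuple.sort (fun i => -|u i|) with hσ
  set K := (Finset.univ.filter fun ν => a ≤ |u ν|).card with hK
  rcases Nat.eq_zero_or_pos K with h0 | hpos
  · rw [h0]; simpa using Real.rpow_nonneg (div_nonneg hs ha.le) r
  have hcard : (Finset.univ.filter fun k => -|u (σ k)| ≤ -a).card = K := by
    rw [hK]
    refine Finset.card_bij (fun k _ => σ k) ?_ ?_ ?_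
    · intro k hk; simpa using hk
    · intro k _ l _ h; exact σ.injective h
    · intro ν hν; exact ⟨σ.symm ν, by simpa using hν, by simp⟩
  have hKp : K ≤ p := by
    rw [hK]; exact (Finset.card_le_univ _).trans (by simp)
  have hm : Monotone fun k => -|u (σ k)| := Tuple.monotone_sort (fun i => -|u i|)
  have h1 := (Tuple.lt_card_le_iff_apply_le_of_monotone
    (j := (⟨K - 1, by omega⟩ : Fin p)) (a := -a) hm).1 (by
      rw [hcard]; simp only; omega)
  have h2 := hu ⟨K - 1, by omega⟩
  have h3 : a ≤ s * (K : ℝ) ^ (-1 / r) := by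
    have hK1 : ((K - 1 : ℕ) : ℝ) + 1 = K := by
      rw [Nat.cast_sub hpos]; simp
    simp only [hK1] at h2
    refine le_trans ?_ h2
    simpa [absOrdered] using h1
  have hKr : (0 : ℝ) < K := by exact_mod_cast hpos
  have h4 : (K : ℝ) ^ (1 / r) ≤ s / a := by
    rw [le_div_iff₀ ha]
    have h5 : (K : ℝ) ^ (1 / r) * (K : ℝ) ^ (-1 / r) = 1 := by
      rw [← Real.rpow_add hKr, neg_div, add_neg_cancel, Real.rpow_zero]
    calc (K : ℝ) ^ (1 / r) * a ≤ (K : ℝ) ^ (1 / r) * (s * (K : ℝ) ^ (-1 / r)) := by gcongr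
      _ = s * ((K : ℝ) ^ (1 / r) * (K : ℝ) ^ (-1 / r)) := by ring
      _ = s := by rw [h5, mul_one]
  calc (K : ℝ) = ((K : ℝ) ^ (1 / r)) ^ r := by
        rw [← Real.rpow_mul hKr.le, one_div_mul_cancel hr.ne', Real.rpow_one]
    _ ≤ (s / a) ^ r := by gcongr

/-- Comparison of a tail of `∑ k ^ (-b)` with the integral of `x ^ (-b)`. -/
lemma sum_Ico_rpow_neg_le {b : ℝ} (hb : 1 < b) {K : ℕ} (hK : 1 ≤ K) (N : ℕ) :
    ∑ k ∈ Finset.Ico K N, ((k : ℝ) + 1) ^ (-b) ≤ (K : ℝ) ^ (1 - b) / (b - 1) := by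
  have hb1 : 0 < b - 1 := by linarith
  rcases le_total N K with h | h
  · rw [Finset.Ico_eq_empty_of_le h]
    simp only [Finset.sum_empty]; positivity
  suffices hmain : ∑ k ∈ Finset.Ico K N, ((k : ℝ) + 1) ^ (-b) ≤
      ((K : ℝ) ^ (1 - b) - (N : ℝ) ^ (1 - b)) / (b - 1) by
    refine hmain.trans ?_
    gcongr
    have : 0 ≤ (N : ℝ) ^ (1 - b) := by positivity
    linarith
  induction N, h using Nat.le_induction with
  | base => simp
  | succ N hN ih =>
    rw [Finset.sum_Ico_succ_top hN]
    have hN0 : (0 : ℝ) < N := by exact_mod_cast (by omega : 0 < N)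
    have hy : 0 < (N : ℝ) / (N + 1) := by positivity
    have key : ((N : ℝ) + 1) ^ (-b) * (b - 1) ≤ (N : ℝ) ^ (1 - b) - ((N : ℝ) + 1) ^ (1 - b) := by
      have e1 : (N : ℝ) ^ (1 - b) = ((N : ℝ) / (N + 1)) ^ (1 - b) * ((N : ℝ) + 1) ^ (1 - b) := by
        rw [← Real.mul_rpow hy.le (by positivity)]
        congr 1; field_simp
      have e2 : ((N : ℝ) + 1) ^ (-b) = ((N : ℝ) + 1) ^ (1 - b) / (N + 1) := by
        rw [show -b = (1 - b) - 1 by ring, Real.rpow_sub_one (by positivity)]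
      have e3 : 1 + (b - 1) / (N + 1) ≤ ((N : ℝ) / (N + 1)) ^ (1 - b) := by
        rw [Real.rpow_def_of_pos hy]
        have l1 := Real.log_le_sub_one_of_pos hy
        have l2 := Real.add_one_le_exp (Real.log ((N : ℝ) / (N + 1)) * (1 - b))
        have l3 : (N : ℝ) / (N + 1) - 1 = -(1 / (N + 1)) := by field_simp; ring
        have l4 : (b - 1) / ((N : ℝ) + 1) = (b - 1) * (1 / (N + 1)) := by ring
        rw [l4]
        nlinarith [l1, l2, l3]
      rw [e1, e2]
      have e4 : 0 < ((N : ℝ) + 1) ^ (1 - b) := by positivity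
      calc ((N : ℝ) + 1) ^ (1 - b) / (N + 1) * (b - 1)
          = (1 + (b - 1) / (N + 1)) * ((N : ℝ) + 1) ^ (1 - b) - ((N : ℝ) + 1) ^ (1 - b) := by ring
        _ ≤ _ := by gcongr
    rw [← le_div_iff₀ hb1] at key
    push_cast
    calc _ ≤ ((K : ℝ) ^ (1 - b) - (N : ℝ) ^ (1 - b)) / (b - 1) +
          ((N : ℝ) ^ (1 - b) - ((N : ℝ) + 1) ^ (1 - b)) / (b - 1) := add_le_add ih key
      _ = _ := by ring

/-- The part of a weak-`ℓ_r` vector (`r < 2`) on coordinates of absolute value at most `a` has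
squared norm of order `a ^ 2 * (s / a) ^ r`. -/
lemma WeakLr.sum_sq_le {r s : ℝ} {p : ℕ} {u : EuclideanSpace ℝ (Fin p)} (hu : WeakLr r s u)
    (hr : 0 < r) (hr2 : r < 2) {a : ℝ} (ha : 0 < a) (hs : 0 < s) (T : Finset (Fin p))
    (hT : ∀ ν ∈ T, |u ν| ≤ a) :
    ∑ ν ∈ T, u ν ^ 2 ≤ a ^ 2 * ((s / a) ^ r * (1 + 1 / (2 / r - 1)) + 1) := by
  set σ := Tuple.sort (fun i => -|u i|) with hσ
  set b := 2 / r with hb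
  have hb1 : 1 < b := by rw [hb, lt_div_iff₀ hr]; linarith
  set x := (s / a) ^ r with hx
  have hx0 : 0 < x := by positivity
  -- beyond rank `K ≈ (s / a) ^ r` the weak-`ℓ_r` bound is the smaller of the two
  set K := ⌈x⌉₊ with hK
  have hK1 : 1 ≤ K := Nat.one_le_iff_ne_zero.2 (by simpa [hK] using hx0)
  have hKx : x ≤ K := Nat.le_ceil x
  have hKx' : (K : ℝ) ≤ x + 1 := (Nat.ceil_lt_add_one hx0.le).le
  have step1 : ∑ ν ∈ T, u ν ^ 2 ≤ ∑ k : Fin p, min (a ^ 2) (s ^ 2 * ((k : ℝ) + 1) ^ (-b)) := by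
    calc ∑ ν ∈ T, u ν ^ 2 ≤ ∑ ν ∈ T, min (a ^ 2) (u ν ^ 2) := by
          refine Finset.sum_le_sum fun ν hν => le_min ?_ le_rfl
          rw [← sq_abs]; exact pow_le_pow_left₀ (abs_nonneg _) (hT ν hν) 2
      _ ≤ ∑ ν, min (a ^ 2) (u ν ^ 2) :=
          Finset.sum_le_univ_sum_of_nonneg fun ν => by positivity
      _ = ∑ k, min (a ^ 2) (u (σ k) ^ 2) := (Equiv.sum_comp σ fun ν => min (a ^ 2) (u ν ^ 2)).symm
      _ ≤ _ := by
          refine Finset.sum_le_sum fun k _ => min_le_min le_rfl ?_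
          have h1 : |u (σ k)| ≤ s * ((k : ℝ) + 1) ^ (-1 / r) := hu k
          have h2 := pow_le_pow_left₀ (abs_nonneg _) h1 2
          rw [sq_abs, mul_pow, ← Real.rpow_natCast, ← Real.rpow_natCast (_ ^ (-1 / r)),
            ← Real.rpow_mul (by positivity)] at h2
          convert h2 using 2
          · simp
          · rw [hb]; push_cast; ring_nf
  have step2 : ∑ k : Fin p, min (a ^ 2) (s ^ 2 * ((k : ℝ) + 1) ^ (-b)) ≤
      a ^ 2 * K + s ^ 2 * ((K : ℝ) ^ (1 - b) / (b - 1)) := by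
    rw [Fin.sum_univ_eq_sum_range (fun k : ℕ => min (a ^ 2) (s ^ 2 * ((k : ℝ) + 1) ^ (-b))) p]
    calc ∑ k ∈ Finset.range p, min (a ^ 2) (s ^ 2 * ((k : ℝ) + 1) ^ (-b))
        ≤ ∑ k ∈ Finset.range (max K p), min (a ^ 2) (s ^ 2 * ((k : ℝ) + 1) ^ (-b)) := by
          refine Finset.sum_le_sum_of_subset_of_nonneg (by simp) fun k _ _ => by positivity
      _ = ∑ k ∈ Finset.range K, min (a ^ 2) (s ^ 2 * ((k : ℝ) + 1) ^ (-b)) +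
          ∑ k ∈ Finset.Ico K (max K p), min (a ^ 2) (s ^ 2 * ((k : ℝ) + 1) ^ (-b)) :=
          (Finset.sum_range_add_sum_Ico _ (le_max_left _ _)).symm
      _ ≤ ∑ k ∈ Finset.range K, a ^ 2 +
          ∑ k ∈ Finset.Ico K (max K p), s ^ 2 * ((k : ℝ) + 1) ^ (-b) := by
          gcongr
          · exact min_le_left _ _
          · exact min_le_right _ _
      _ ≤ _ := by
          rw [← Finset.mul_sum, Finset.sum_const, Finset.card_range, nsmul_eq_mul, mul_comm]
          gcongr
          exact sum_Ico_rpow_neg_le hb1 hK1 _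
  have hb0 : 0 < b - 1 := by linarith
  have step3 : s ^ 2 * ((K : ℝ) ^ (1 - b) / (b - 1)) ≤ a ^ 2 * (x * (1 / (b - 1))) := by
    have h1 : (K : ℝ) ^ (1 - b) ≤ x ^ (1 - b) :=
      Real.rpow_le_rpow_of_nonpos hx0 hKx (by linarith)
    have h2 : x ^ (1 - b) = x * (s / a) ^ (-2 : ℝ) := by
      rw [sub_eq_add_neg, Real.rpow_add hx0, Real.rpow_one, hx, ← Real.rpow_mul (by positivity)]
      congr 2; rw [hb]; field_simp
    have h3 : (s / a) ^ (-2 : ℝ) = a ^ 2 / s ^ 2 := by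
      rw [Real.rpow_neg (by positivity)]
      norm_cast
      rw [div_pow, inv_div]
    calc s ^ 2 * ((K : ℝ) ^ (1 - b) / (b - 1)) ≤ s ^ 2 * (x ^ (1 - b) / (b - 1)) := by gcongr
      _ = _ := by rw [h2, h3]; field_simp
  calc _ ≤ a ^ 2 * (x + 1) + a ^ 2 * (x * (1 / (b - 1))) := by
        refine (step1.trans step2).trans (add_le_add ?_ step3)
        gcongr
    _ = _ := by ring

end SparsePCA

namespace SparsePCA

/-! ### Min-max bounds for ordered eigenvalues -/

open Matrix in
/-- An orthonormal eigenbasis in the order of the eigenvalues, with the resulting diagonal forms of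
`x ⬝ᵥ x` and `x ⬝ᵥ A *ᵥ x`. -/
lemma exists_ordered_eigenbasis {ι : Type*} [Fintype ι] [DecidableEq ι] {A : Matrix ι ι ℝ}
    (hA : A.IsHermitian) : ∃ b : Fin (Fintype.card ι) → ι → ℝ,
      (∀ k l, b k ⬝ᵥ b l = if k = l then 1 else 0) ∧
      (∀ x, x ⬝ᵥ x = ∑ k, (b k ⬝ᵥ x) ^ 2) ∧
      (∀ x, x ⬝ᵥ A *ᵥ x = ∑ k, hA.eigenvalues₀ k * (b k ⬝ᵥ x) ^ 2) := by
  set e : Fin (Fintype.card ι) ≃ ι := Fintype.equivOfCardEq (Fintype.card_fin _) with he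
  set B := hA.eigenvectorBasis.reindex e.symm with hB
  have hin : ∀ k (x : ι → ℝ), inner ℝ (B k) (WithLp.toLp 2 x) = (B k).ofLp ⬝ᵥ x := by
    intro k x
    simp [PiLp.inner_apply, dotProduct, mul_comm]
  have hAB : ∀ k, A *ᵥ (B k).ofLp = hA.eigenvalues₀ k • (B k).ofLp := by
    intro k
    have := hA.mulVec_eigenvectorBasis (e k)
    simpa [hB, IsHermitian.eigenvalues, he] using this
  have hexp : ∀ x : ι → ℝ, x = ∑ k, ((B k).ofLp ⬝ᵥ x) • (B k).ofLp := by
    intro x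
    have := congrArg WithLp.ofLp (B.sum_repr' (WithLp.toLp 2 x))
    simp only [hin, WithLp.ofLp_sum, WithLp.ofLp_smul] at this
    exact this.symm
  refine ⟨fun k => (B k).ofLp, ?_, ?_, ?_⟩
  · intro k l
    have := hin k (B l).ofLp
    rw [← this]
    exact orthonormal_iff_ite.1 B.orthonormal k l
  · intro x
    have h1 : x ⬝ᵥ x = (∑ k, ((B k).ofLp ⬝ᵥ x) • (B k).ofLp) ⬝ᵥ x := congrArg (· ⬝ᵥ x) (hexp x)
    rw [h1, sum_dotProduct]
    refine Finset.sum_congr rfl fun k _ => ?_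
    rw [smul_dotProduct, smul_eq_mul, sq]
  · intro x
    have h1 : A *ᵥ x = ∑ k, ((B k).ofLp ⬝ᵥ x) • hA.eigenvalues₀ k • (B k).ofLp := by
      conv_lhs => rw [hexp x]
      rw [mulVec_sum]
      simp only [mulVec_smul, hAB]
    rw [h1, dotProduct_sum]
    refine Finset.sum_congr rfl fun k _ => ?_
    rw [dotProduct_smul, dotProduct_smul, dotProduct_comm x]
    simp only [smul_eq_mul]; ring

open Matrix in
/-- Upper min-max bound: a bound of the quadratic form on the orthogonal complement of `k` vectors
bounds the `(k + 1)`-st eigenvalue. -/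
lemma eval_le_of_orthogonal {ι : Type*} [Fintype ι] [DecidableEq ι] {A : Matrix ι ι ℝ}
    {k : ℕ} (v : Fin k → ι → ℝ) {a : ℝ} (ha : 0 ≤ a)
    (h : ∀ x : ι → ℝ, (∀ i, v i ⬝ᵥ x = 0) → x ⬝ᵥ A *ᵥ x ≤ a * (x ⬝ᵥ x)) :
    eval A (k + 1) ≤ a := by
  unfold eval
  split_ifs with hc
  swap
  · exact ha
  obtain ⟨hA, -, hk⟩ := hc
  by_contra! hlt
  simp only [add_tsub_cancel_right] at hlt
  obtain ⟨b, hb, hxx, hAx⟩ := exists_ordered_eigenbasis hA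
  set c := Fin.castLE hk with hcdef
  set F : (Fin (k + 1) → ℝ) →ₗ[ℝ] (ι → ℝ) := Fintype.linearCombination ℝ (fun i => b (c i))
  set G : (Fin (k + 1) → ℝ) →ₗ[ℝ] (Fin k → ℝ) := (Matrix.of v).mulVecLin ∘ₗ F
  -- some vector in the span of the top `k + 1` eigenvectors is orthogonal to every `v i`
  have hker : LinearMap.ker G ≠ ⊥ := LinearMap.ker_ne_bot_of_finrank_lt (by simp)
  obtain ⟨z, hz, hz0⟩ := (Submodule.ne_bot_iff _).1 hker
  have hx0 : ∀ i, v i ⬝ᵥ F z = 0 := fun i => congrFun (LinearMap.mem_ker.1 hz) i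
  have hco : ∀ l, b l ⬝ᵥ F z = ∑ i, z i * (if l = c i then 1 else 0) := by
    intro l
    simp only [F, Fintype.linearCombination_apply, dotProduct_sum, dotProduct_smul, hb, smul_eq_mul]
  have hco1 : ∀ i, b (c i) ⬝ᵥ F z = z i := by
    intro i
    rw [hco, Finset.sum_eq_single i]
    · simp
    · intro j _ hj
      have : c i ≠ c j := fun h => hj (Fin.castLE_injective hk h).symm
      simp [this]
    · simp
  have hpos : 0 < F z ⬝ᵥ F z := by
    obtain ⟨i, hi⟩ := Function.ne_iff.1 hz0
    rw [hxx]
    refine Finset.sum_pos' (fun l _ => sq_nonneg _) ⟨c i, Finset.mem_univ _, ?_⟩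
    rw [hco1]
    exact sq_pos_of_ne_zero hi
  have hge : hA.eigenvalues₀ ⟨k, hk⟩ * (F z ⬝ᵥ F z) ≤ F z ⬝ᵥ A *ᵥ F z := by
    rw [hxx, hAx, Finset.mul_sum]
    refine Finset.sum_le_sum fun l _ => ?_
    by_cases hl : (l : ℕ) < k + 1
    · have : hA.eigenvalues₀ ⟨k, hk⟩ ≤ hA.eigenvalues₀ l :=
        hA.eigenvalues₀_antitone (by rw [Fin.le_def]; simp only; omega)
      exact mul_le_mul_of_nonneg_right this (sq_nonneg _)
    · have : b l ⬝ᵥ F z = 0 := by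
        rw [hco]
        refine Finset.sum_eq_zero fun i _ => ?_
        have : l ≠ c i := by
          intro h; apply hl; rw [h, hcdef]; exact i.isLt
        simp [this]
      simp [this]
  have h1 := h (F z) hx0
  nlinarith

open Matrix in
/-- Lower min-max bound: a lower bound of the quadratic form on the span of `j` linearly independent
vectors bounds the `j`-th eigenvalue from below. -/
lemma le_eval_of_linearIndependent {ι : Type*} [Fintype ι] [DecidableEq ι] {A : Matrix ι ι ℝ}
    (hA : A.IsHermitian) {k : ℕ} (f : Fin (k + 1) → ι → ℝ) (hf : LinearIndependent ℝ f) {a : ℝ}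
    (h : ∀ z : Fin (k + 1) → ℝ,
      a * ((∑ i, z i • f i) ⬝ᵥ (∑ i, z i • f i)) ≤
        (∑ i, z i • f i) ⬝ᵥ A *ᵥ (∑ i, z i • f i)) :
    a ≤ eval A (k + 1) := by
  have hk : k + 1 ≤ Fintype.card ι := by
    simpa using hf.fintype_card_le_finrank
  unfold eval
  rw [dif_pos ⟨hA, by omega, hk⟩]
  simp only [add_tsub_cancel_right]
  by_contra! hlt
  obtain ⟨b, hb, hxx, hAx⟩ := exists_ordered_eigenbasis hA
  set F : (Fin (k + 1) → ℝ) →ₗ[ℝ] (ι → ℝ) := Fintype.linearCombination ℝ f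
  set G : (Fin (k + 1) → ℝ) →ₗ[ℝ] (Fin k → ℝ) :=
    (Matrix.of fun i : Fin k => b (Fin.castLE (by omega) i)).mulVecLin ∘ₗ F
  -- some vector in the span of `f` is orthogonal to the top `k` eigenvectors
  have hker : LinearMap.ker G ≠ ⊥ := LinearMap.ker_ne_bot_of_finrank_lt (by simp)
  obtain ⟨z, hz, hz0⟩ := (Submodule.ne_bot_iff _).1 hker
  have hx0 : ∀ i : Fin k, b (Fin.castLE (by omega) i) ⬝ᵥ F z = 0 :=
    fun i => congrFun (LinearMap.mem_ker.1 hz) i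
  have hFz : F z ≠ 0 := by
    intro h0
    exact hz0 (funext (Fintype.linearIndependent_iff.1 hf z h0))
  have hpos : 0 < F z ⬝ᵥ F z := by
    refine lt_of_le_of_ne (by rw [hxx]; positivity) (Ne.symm ?_)
    simpa using hFz
  have hle : F z ⬝ᵥ A *ᵥ F z ≤ hA.eigenvalues₀ ⟨k, hk⟩ * (F z ⬝ᵥ F z) := by
    rw [hxx, hAx, Finset.mul_sum]
    refine Finset.sum_le_sum fun l _ => ?_
    by_cases hl : (l : ℕ) < k
    · have : b l ⬝ᵥ F z = 0 := hx0 ⟨l, hl⟩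
      simp [this]
    · have : hA.eigenvalues₀ l ≤ hA.eigenvalues₀ ⟨k, hk⟩ :=
        hA.eigenvalues₀_antitone (by rw [Fin.le_def]; simp only; omega)
      exact mul_le_mul_of_nonneg_right this (sq_nonneg _)
  have h1 : a * (F z ⬝ᵥ F z) ≤ F z ⬝ᵥ A *ᵥ F z := h z
  nlinarith

end SparsePCA

namespace SparsePCA

/-! ### Concentration of Gaussian quadratic forms -/

open scoped NNReal

/-- The moment generating function of the square of a centred Gaussian variable. -/
lemma integral_exp_mul_sq_gaussianReal {v : ℝ≥0} (hv : v ≠ 0) {u : ℝ} (hu : u < 1) :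
    ∫ x, Real.exp (u / (2 * v) * x ^ 2) ∂(gaussianReal 0 v) =
      Real.exp (-(1 / 2) * Real.log (1 - u)) := by
  have hv0 : (0 : ℝ) < v := by positivity
  have hu0 : 0 < 1 - u := by linarith
  rw [integral_gaussianReal_eq_integral_smul hv]
  have h1 : ∀ x : ℝ, gaussianPDFReal 0 v x • Real.exp (u / (2 * v) * x ^ 2) =
      (√(2 * Real.pi * v))⁻¹ * Real.exp (-((1 - u) / (2 * v)) * x ^ 2) := by
    intro x
    rw [gaussianPDFReal, smul_eq_mul, mul_assoc, ← Real.exp_add]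
    congr 2
    field_simp
    ring
  simp_rw [h1]
  rw [integral_const_mul, integral_gaussian]
  have h2 : Real.exp (-(1 / 2) * Real.log (1 - u)) = (√(1 - u))⁻¹ := by
    rw [Real.sqrt_eq_rpow, ← Real.rpow_neg hu0.le, Real.rpow_def_of_pos hu0]
    ring_nf
  rw [h2, ← Real.sqrt_inv, ← Real.sqrt_inv, ← Real.sqrt_mul (by positivity)]
  congr 1
  field_simp

/-- Second-order expansion of the logarithm, with the constant that the sharp tail requires. -/
lemma neg_log_one_sub_le {u : ℝ} (hu : |u| ≤ 1 / 20) :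
    -Real.log (1 - u) - u ≤ 21 / 38 * u ^ 2 := by
  have h := Real.abs_log_sub_add_sum_range_le (x := u) (by linarith) 2
  simp only [Finset.sum_range_succ, Finset.sum_range_zero] at h
  have h2 : |u| ^ 3 / (1 - |u|) ≤ 1 / 19 * u ^ 2 := by
    rw [div_le_iff₀ (by linarith), ← sq_abs u]
    nlinarith [sq_nonneg (|u|), abs_nonneg u]
  have h3 := neg_abs_le (0 + u ^ (0 + 1) / ((0 : ℕ) + 1 : ℝ) + u ^ (1 + 1) / ((1 : ℕ) + 1 : ℝ) +
    Real.log (1 - u))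
  norm_num at h h3
  linarith

variable {Ω : Type*} [MeasurableSpace Ω] {P : Measure Ω} [IsProbabilityMeasure P]

/-- Chernoff bound for a scaled `χ²` variable. The optimal exponent for small `ε` is `n ε² / 4`;
the rate `11 / 50` is close enough to `1 / 4` for the diagonal entries, where `ε` is `2√3` times the
noise level and a union bound over `p` coordinates has to remain summable in `n`. The strict
inequality in the event also covers `v = 0`. -/
lemma measureReal_sum_sq_sub_gt_le {n : ℕ} {v : ℝ≥0} {Y : Fin n → Ω → ℝ}
    (hY : ∀ i, HasLaw (Y i) (gaussianReal 0 v) P) (hind : iIndepFun Y P)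
    {ε : ℝ} (hε0 : 0 < ε) (hε : ε ≤ 1 / 20) :
    P.real {ω | n * ε * v < |∑ i, Y i ω ^ 2 - n * v|} ≤
      2 * Real.exp (-(11 / 50) * (n * ε ^ 2)) := by
  rcases eq_or_ne v 0 with rfl | hv
  · have h0 : ∀ᵐ ω ∂P, ∀ i, Y i ω = 0 := by
      rw [ae_all_iff]
      intro i
      exact HasLaw.ae_eq_of_dirac (by simpa using hY i)
    have : P.real {ω | n * ε * ((0 : ℝ≥0) : ℝ) < |∑ i, Y i ω ^ 2 - n * ((0 : ℝ≥0) : ℝ)|} = 0 := by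
      rw [measureReal_eq_zero_iff]
      refine measure_mono_null ?_ (ae_iff.1 h0)
      intro ω hω hω'
      simp [hω'] at hω
    rw [this]; positivity
  have hv0 : (0 : ℝ) < v := by positivity
  set Z : Fin n → Ω → ℝ := fun i ω => Y i ω ^ 2 with hZ
  have hZm : ∀ i, AEMeasurable (Z i) P := fun i => (hY i).aemeasurable.pow_const 2
  have hZind : iIndepFun Z P := hind.comp (fun _ x => x ^ 2) (fun _ => by fun_prop)
  have hmgf1 : ∀ i {u : ℝ}, u < 1 →
      mgf (Z i) P (u / (2 * v)) = Real.exp (-(1 / 2) * Real.log (1 - u)) := by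
    intro i u hu
    rw [← integral_exp_mul_sq_gaussianReal hv hu]
    exact (hY i).integral_comp (f := fun x => Real.exp (u / (2 * v) * x ^ 2)) (by fun_prop)
  have hmgf : ∀ {u : ℝ}, u < 1 → mgf (∑ i, Z i) P (u / (2 * v)) =
      Real.exp (n * (-(1 / 2) * Real.log (1 - u))) := by
    intro u hu
    rw [hZind.mgf_sum₀ hZm]
    simp only [hmgf1 _ hu, Finset.prod_const, Finset.card_univ, Fintype.card_fin]
    rw [← Real.exp_nat_mul]
  have hint : ∀ {u : ℝ}, u < 1 →
      Integrable (fun ω => Real.exp (u / (2 * v) * (∑ i, Z i) ω)) P := by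
    intro u hu
    -- a function that is not integrable would have integral `0`, not a positive one
    by_contra h
    have := hmgf hu
    rw [mgf, integral_undef h] at this
    exact (Real.exp_pos _).ne this
  have hup : P.real {ω | n * v * (1 + ε) ≤ (∑ i, Z i) ω} ≤
      Real.exp (-(11 / 50) * (n * ε ^ 2)) := by
    have h := measure_ge_le_exp_mul_mgf (μ := P) (X := ∑ i, Z i) (t := ε / (2 * v))
      (n * v * (1 + ε)) (by positivity) (hint (by linarith))
    rw [hmgf (by linarith), ← Real.exp_add] at h
    refine h.trans (Real.exp_le_exp.2 ?_)
    have hl := neg_log_one_sub_le (u := ε) (by rw [abs_of_pos hε0]; exact hε)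
    have e : -(ε / (2 * v)) * (n * v * (1 + ε)) = -(n * (ε * (1 + ε) / 2)) := by field_simp
    rw [e]
    have hn : (0 : ℝ) ≤ n := Nat.cast_nonneg n
    nlinarith [mul_le_mul_of_nonneg_left hl hn, mul_nonneg hn (sq_nonneg ε)]
  have hlo : P.real {ω | (∑ i, Z i) ω ≤ n * v * (1 - ε)} ≤
      Real.exp (-(11 / 50) * (n * ε ^ 2)) := by
    have h := measure_le_le_exp_mul_mgf (μ := P) (X := ∑ i, Z i) (t := (-ε) / (2 * v))
      (n * v * (1 - ε)) (div_nonpos_of_nonpos_of_nonneg (by linarith) (by positivity))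
      (hint (by linarith))
    rw [hmgf (by linarith), ← Real.exp_add] at h
    refine h.trans (Real.exp_le_exp.2 ?_)
    have hl := neg_log_one_sub_le (u := -ε) (by rw [abs_neg, abs_of_pos hε0]; exact hε)
    have e : -(-ε / (2 * v)) * (n * v * (1 - ε)) = n * (ε * (1 - ε) / 2) := by field_simp
    rw [e]
    have hn : (0 : ℝ) ≤ n := Nat.cast_nonneg n
    nlinarith [mul_le_mul_of_nonneg_left hl hn, mul_nonneg hn (sq_nonneg ε)]
  have hsub : {ω | n * ε * v < |∑ i, Y i ω ^ 2 - n * v|} ⊆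
      {ω | n * v * (1 + ε) ≤ (∑ i, Z i) ω} ∪ {ω | (∑ i, Z i) ω ≤ n * v * (1 - ε)} := by
    intro ω hω
    simp only [Set.mem_ofPred_eq, lt_abs] at hω
    simp only [Set.mem_union, Set.mem_ofPred_eq, Finset.sum_apply, hZ]
    rcases hω with h | h
    · left; linarith
    · right; linarith
  calc _ ≤ _ := measureReal_mono hsub
    _ ≤ _ := measureReal_union_le _ _
    _ ≤ _ := add_le_add hup hlo
    _ = _ := by ring

open Matrix

/-! ### Concentration of the sample covariance -/

/-- The quadratic form of the sample covariance matrix is the mean of the squared projections. -/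
lemma dotProduct_sampleCov_mulVec {n p : ℕ} (x : Fin n → EuclideanSpace ℝ (Fin p))
    (u w : Fin p → ℝ) :
    u ⬝ᵥ sampleCov x *ᵥ w = (n : ℝ)⁻¹ * ∑ i, (u ⬝ᵥ (x i).ofLp) * (w ⬝ᵥ (x i).ofLp) := by
  rw [sampleCov, smul_mulVec, sum_mulVec, dotProduct_smul, dotProduct_sum, smul_eq_mul]
  congr 1
  refine Finset.sum_congr rfl fun i _ => ?_
  rw [vecMulVec_mulVec, dotProduct_smul, dotProduct_comm w]
  simp

lemma sampleCov_isHermitian {n p : ℕ} (x : Fin n → EuclideanSpace ℝ (Fin p)) :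
    (sampleCov x).IsHermitian := by
  ext i j
  simp [sampleCov, Matrix.sum_apply, vecMulVec_apply, mul_comm]

namespace SpikedModel

variable {mbar : ℕ} (M : SpikedModel mbar)

lemma dotProduct_cov_mulVec (n : ℕ) (x y : Fin (M.p n) → ℝ) :
    x ⬝ᵥ M.cov n *ᵥ y = x ⬝ᵥ y +
      ∑ j, M.lam n j ^ 2 * (((M.q n j).ofLp ⬝ᵥ x) * ((M.q n j).ofLp ⬝ᵥ y)) := by
  rw [cov, add_mulVec, one_mulVec, dotProduct_add, add_comm, sum_mulVec, dotProduct_sum]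
  congr 1
  refine Finset.sum_congr rfl fun i _ => ?_
  rw [smul_mulVec, vecMulVec_mulVec, dotProduct_smul, dotProduct_smul, dotProduct_comm x]
  simp

lemma cov_posSemidef (n : ℕ) : (M.cov n).PosSemidef := by
  refine PosSemidef.of_dotProduct_mulVec_nonneg ?_ fun x => ?_
  · ext i j
    simp [cov, Matrix.sum_apply, vecMulVec_apply, mul_comm, Matrix.one_apply, eq_comm]
  · rw [star_trivial, dotProduct_cov_mulVec]
    refine add_nonneg (Finset.sum_nonneg fun i _ => mul_self_nonneg (x i)) (Finset.sum_nonneg fun j _ => ?_)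
    exact mul_nonneg (sq_nonneg _) (mul_self_nonneg _)

/-- Linear functionals of the sample are Gaussian. -/
lemma hasLaw_dotProduct {P : Measure Ω} {n : ℕ} {X : Ω → EuclideanSpace ℝ (Fin (M.p n))}
    (hX : HasLaw X (multivariateGaussian 0 (M.cov n)) P) (u : Fin (M.p n) → ℝ) :
    HasLaw (fun ω => u ⬝ᵥ (X ω).ofLp) (gaussianReal 0 (u ⬝ᵥ M.cov n *ᵥ u).toNNReal) P := by
  set g := innerSL ℝ (WithLp.toLp 2 u : EuclideanSpace ℝ (Fin (M.p n)))
  have hg : ∀ x, g x = u ⬝ᵥ x.ofLp := by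
    intro x; simp [g, PiLp.inner_apply, dotProduct, mul_comm]
  have hmap : (multivariateGaussian 0 (M.cov n)).map g =
      gaussianReal 0 (u ⬝ᵥ M.cov n *ᵥ u).toNNReal := by
    rw [IsGaussian.map_eq_gaussianReal,
      ContinuousLinearMap.integral_comp_id_comm IsGaussian.integrable_id]
    congr 1
    · simp
    · congr 1
      have h := covarianceBilin_multivariateGaussian (μ := 0) (M.cov_posSemidef n)
        (WithLp.toLp 2 u) (WithLp.toLp 2 u)
      rw [covarianceBilin_self IsGaussian.memLp_two_id] at h
      exact h
  have := HasLaw.comp (X := X) (Y := g) (ν := gaussianReal 0 (u ⬝ᵥ M.cov n *ᵥ u).toNNReal)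
    ⟨by fun_prop, hmap⟩ hX
  exact this.congr (ae_of_all _ fun ω => (hg _).symm)

/-- The entrywise noise level `√(log (max p n) / n)`. -/
noncomputable def noiseLevel (n : ℕ) : ℝ := Real.sqrt (Real.log (M.pmax n) / n)

lemma one_le_pmax {n : ℕ} (hn : 1 ≤ n) : (1 : ℝ) ≤ M.pmax n := by
  unfold pmax; exact_mod_cast le_max_of_le_right hn

lemma le_pmax (n : ℕ) : (n : ℝ) ≤ M.pmax n := by
  unfold pmax; exact_mod_cast le_max_right _ _

lemma dim_le_pmax (n : ℕ) : (M.p n : ℝ) ≤ M.pmax n := by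
  unfold pmax; exact_mod_cast le_max_left _ _

lemma noiseLevel_pos {n : ℕ} (hn : 2 ≤ n) : 0 < M.noiseLevel n := by
  have h1 : (2 : ℝ) ≤ M.pmax n := le_trans (by exact_mod_cast hn) (M.le_pmax n)
  have h2 := Real.log_pos (show 1 < M.pmax n by linarith)
  have h3 : (0 : ℝ) < n := by exact_mod_cast (by omega : 0 < n)
  exact Real.sqrt_pos.2 (by positivity)

lemma mul_noiseLevel_sq {n : ℕ} (hn : 1 ≤ n) : n * M.noiseLevel n ^ 2 = Real.log (M.pmax n) := by
  have h3 : (0 : ℝ) < n := by exact_mod_cast (by omega : 0 < n)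
  rw [noiseLevel, Real.sq_sqrt (div_nonneg (Real.log_nonneg (M.one_le_pmax hn)) h3.le)]
  field_simp

/-- Almost surely, for all large `n`, the relative error of the quadratic form of the sample
covariance is at most `c` times the noise level, simultaneously over at most `2 (max p n) ^ k`
vectors; the constant `c` is tied to `k` by the union bound and the Borel–Cantelli lemma. -/
lemma IsSample.ae_eventually_quadForm {M : SpikedModel mbar}
    {X : (n : ℕ) → Fin n → Ω → EuclideanSpace ℝ (Fin (M.p n))} (hX : M.IsSample P X)
    (hτ : Tendsto M.noiseLevel atTop (𝓝 0)) {ι : ℕ → Type*} [∀ n, Fintype (ι n)]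
    (u : ∀ n, ι n → Fin (M.p n) → ℝ) {k c : ℝ}
    (hcard : ∀ n, (Fintype.card (ι n) : ℝ) ≤ 2 * M.pmax n ^ k) (hc0 : 0 < c)
    (hc : k + 3 / 2 ≤ 11 / 50 * c ^ 2) :
    ∀ᵐ ω ∂P, ∀ᶠ n in atTop, ∀ i,
      |u n i ⬝ᵥ sampleCov (X n · ω) *ᵥ u n i - u n i ⬝ᵥ M.cov n *ᵥ u n i| ≤
        c * M.noiseLevel n * (u n i ⬝ᵥ M.cov n *ᵥ u n i) := by
  have hsmall : ∀ᶠ n in atTop, M.noiseLevel n < 1 / (20 * c) :=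
    hτ.eventually_lt_const (by positivity)
  obtain ⟨N, hN⟩ := eventually_atTop.1 (hsmall.and (eventually_ge_atTop 2))
  set bad : ∀ n, ι n → Set Ω := fun n i => {ω |
    n * (c * M.noiseLevel n) * ((u n i ⬝ᵥ M.cov n *ᵥ u n i).toNNReal : ℝ) <
      |∑ l, (u n i ⬝ᵥ (X n l ω).ofLp) ^ 2 - n * ((u n i ⬝ᵥ M.cov n *ᵥ u n i).toNNReal : ℝ)|}
    with hbad
  -- the tail bound needs a small deviation, so the bad events are dropped for `n < N`
  set E : ℕ → Set Ω := fun n => if N ≤ n then ⋃ i, bad n i else ∅ with hE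
  have hEn : ∀ n, P (E n) ≤ ENNReal.ofReal (4 * (n : ℝ) ^ (-(3 / 2) : ℝ)) := by
    intro n
    by_cases hn : N ≤ n
    swap
    · simp [hE, hn]
    obtain ⟨h1, h2⟩ := hN n hn
    have hp1 := M.one_le_pmax (show 1 ≤ n by omega)
    have hp0 : 0 < M.pmax n := by linarith
    have hτ0 := M.noiseLevel_pos h2
    have hε : c * M.noiseLevel n ≤ 1 / 20 := by
      rw [lt_div_iff₀ (by positivity)] at h1
      linarith
    have hb : ∀ i, P.real (bad n i) ≤ 2 * M.pmax n ^ (-(11 / 50 * c ^ 2)) := by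
      intro i
      have := measureReal_sum_sq_sub_gt_le (P := P)
        (Y := fun l ω => u n i ⬝ᵥ (X n l ω).ofLp)
        (fun l => M.hasLaw_dotProduct ((hX n).1 l) (u n i))
        ((hX n).2.comp (fun _ x => u n i ⬝ᵥ x.ofLp) (fun _ => by
          simp only [dotProduct]; fun_prop)) (by positivity) hε
      refine this.trans (le_of_eq ?_)
      rw [mul_pow, mul_left_comm (n : ℝ), M.mul_noiseLevel_sq (by omega), Real.rpow_def_of_pos hp0]
      ring_nf
    rw [show E n = ⋃ i, bad n i by simp [hE, hn]]
    rw [← ofReal_measureReal]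
    refine ENNReal.ofReal_le_ofReal ?_
    calc P.real (⋃ i, bad n i) ≤ ∑ i, P.real (bad n i) := measureReal_iUnion_fintype_le _
      _ ≤ ∑ i : ι n, 2 * M.pmax n ^ (-(11 / 50 * c ^ 2)) := Finset.sum_le_sum fun i _ => hb i
      _ = Fintype.card (ι n) * (2 * M.pmax n ^ (-(11 / 50 * c ^ 2))) := by simp
      _ ≤ (2 * M.pmax n ^ k) * (2 * M.pmax n ^ (-(11 / 50 * c ^ 2))) := by
          gcongr; exact hcard n
      _ = 4 * M.pmax n ^ (k + -(11 / 50 * c ^ 2)) := by rw [Real.rpow_add hp0]; ring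
      _ ≤ 4 * M.pmax n ^ (-(3 / 2) : ℝ) := by
          gcongr
          linarith
      _ ≤ 4 * (n : ℝ) ^ (-(3 / 2) : ℝ) := by
          gcongr 4 * ?_
          exact Real.rpow_le_rpow_of_nonpos (by exact_mod_cast (by omega : 0 < n)) (M.le_pmax n)
            (by norm_num)
  have hsum : (∑' n, P (E n)) ≠ ∞ := by
    have hs : Summable fun n : ℕ => 4 * (n : ℝ) ^ (-(3 / 2) : ℝ) :=
      (Real.summable_nat_rpow.2 (by norm_num)).mul_left 4
    exact ne_top_of_le_ne_top hs.tsum_ofReal_ne_top (ENNReal.tsum_le_tsum hEn)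
  filter_upwards [ae_eventually_notMem hsum] with ω hω
  filter_upwards [hω, eventually_ge_atTop (max N 1)] with n hn hnN i
  have hn0 : (0 : ℝ) < n := by exact_mod_cast (by omega : 0 < n)
  have hq := (M.cov_posSemidef n).dotProduct_mulVec_nonneg (u n i)
  rw [star_trivial] at hq
  simp only [hE, show N ≤ n by omega, if_true, Set.mem_iUnion, not_exists, hbad,
    Set.mem_ofPred_eq, not_lt] at hn
  have h := hn i
  rw [Real.coe_toNNReal _ hq] at h
  rw [dotProduct_sampleCov_mulVec]
  simp only [← sq]
  rw [← mul_le_mul_iff_right₀ hn0, ← abs_of_pos hn0, ← abs_mul, abs_of_pos hn0]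
  calc _ = |∑ l, (u n i ⬝ᵥ (X n l ω).ofLp) ^ 2 - n * (u n i ⬝ᵥ M.cov n *ᵥ u n i)| := by
        congr 1; field_simp
    _ ≤ _ := h
    _ = _ := by ring

lemma noiseLevel_nonneg (n : ℕ) : 0 ≤ M.noiseLevel n := Real.sqrt_nonneg _

lemma cov_apply_self (n : ℕ) (ν : Fin (M.p n)) :
    M.cov n ν ν = 1 + ∑ j, M.lam n j ^ 2 * M.q n j ν ^ 2 := by
  simp [cov, Matrix.sum_apply, vecMulVec_apply, sq, add_comm]

lemma one_le_cov_apply_self (n : ℕ) (ν : Fin (M.p n)) : 1 ≤ M.cov n ν ν := by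
  rw [cov_apply_self]
  have : 0 ≤ ∑ j, M.lam n j ^ 2 * M.q n j ν ^ 2 := by positivity
  linarith

/-- The constant `2√3` for the diagonal entries is the one that the threshold `α > 2√3` has to
exceed. -/
lemma IsSample.ae_eventually_diag {M : SpikedModel mbar}
    {X : (n : ℕ) → Fin n → Ω → EuclideanSpace ℝ (Fin (M.p n))} (hX : M.IsSample P X)
    (hτ : Tendsto M.noiseLevel atTop (𝓝 0)) :
    ∀ᵐ ω ∂P, ∀ᶠ n in atTop, ∀ ν, |sampleCov (X n · ω) ν ν - M.cov n ν ν| ≤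
        2 * √3 * M.noiseLevel n * M.cov n ν ν := by
  have h := hX.ae_eventually_quadForm hτ (ι := fun n => Fin (M.p n))
    (fun n ν => Pi.single ν 1) (k := 1) (c := 2 * √3)
    (fun n => by
      have h1 := M.dim_le_pmax n
      have h2 : 0 ≤ M.pmax n := (Nat.cast_nonneg _).trans h1
      rw [Real.rpow_one, Fintype.card_fin]; linarith) (by positivity)
    (by rw [mul_pow, Real.sq_sqrt (by norm_num)]; norm_num)
  simpa using h

/-- Entrywise concentration, from that of quadratic forms by polarization. -/
lemma IsSample.ae_eventually_entry {M : SpikedModel mbar}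
    {X : (n : ℕ) → Fin n → Ω → EuclideanSpace ℝ (Fin (M.p n))} (hX : M.IsSample P X)
    (hτ : Tendsto M.noiseLevel atTop (𝓝 0)) :
    ∀ᵐ ω ∂P, ∀ᶠ n in atTop, ∀ ν μ, |sampleCov (X n · ω) ν μ - M.cov n ν μ| ≤
        8 * M.noiseLevel n * (√(M.cov n ν ν) * √(M.cov n μ μ)) := by
  have h := hX.ae_eventually_quadForm hτ (ι := fun n => (Fin (M.p n) × Fin (M.p n)) × Bool)
    (fun n i => Pi.single i.1.1 (√(M.cov n i.1.1 i.1.1))⁻¹ +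
      Pi.single i.1.2 (bif i.2 then (√(M.cov n i.1.2 i.1.2))⁻¹
        else -(√(M.cov n i.1.2 i.1.2))⁻¹)) (k := 2) (c := 8)
    (fun n => by
      have h1 := M.dim_le_pmax n
      have h2 : (0 : ℝ) ≤ M.p n := Nat.cast_nonneg _
      simp only [Fintype.card_prod, Fintype.card_fin, Fintype.card_bool]
      push_cast
      rw [Real.rpow_two]
      nlinarith) (by positivity) (by norm_num)
  filter_upwards [h] with ω hω
  filter_upwards [hω] with n hn ν μ
  have hν : 0 < √(M.cov n ν ν) := Real.sqrt_pos.2 (by linarith [M.one_le_cov_apply_self n ν])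
  have hμ : 0 < √(M.cov n μ μ) := Real.sqrt_pos.2 (by linarith [M.one_le_cov_apply_self n μ])
  have eν : M.cov n ν ν = √(M.cov n ν ν) ^ 2 :=
    (Real.sq_sqrt (by linarith [M.one_le_cov_apply_self n ν])).symm
  have eμ : M.cov n μ μ = √(M.cov n μ μ) ^ 2 :=
    (Real.sq_sqrt (by linarith [M.one_le_cov_apply_self n μ])).symm
  have h1 := hn ((ν, μ), true)
  have h2 := hn ((ν, μ), false)
  have hS : sampleCov (X n · ω) μ ν = sampleCov (X n · ω) ν μ :=
    (sampleCov_isHermitian (X n · ω)).apply ν μ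
  have hC : M.cov n μ ν = M.cov n ν μ := (M.cov_posSemidef n).1.apply ν μ
  simp only [cond_true, cond_false, mulVec_add, dotProduct_add, add_dotProduct,
    single_dotProduct, mulVec_single, Pi.smul_apply, op_smul_eq_smul, col_apply,
    smul_eq_mul, hS, hC] at h1 h2
  generalize sampleCov (X n · ω) ν μ = b at *
  generalize sampleCov (X n · ω) ν ν = a at *
  generalize sampleCov (X n · ω) μ μ = d at *
  generalize M.cov n ν μ = b' at *
  set y := √(M.cov n ν ν)
  set z := √(M.cov n μ μ)
  rw [eν, eμ] at h1 h2
  have key : |4 * ((b - b') * (y⁻¹ * z⁻¹))| ≤ 4 * (8 * M.noiseLevel n) := by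
    have e1 : M.noiseLevel n * (y⁻¹ * (y ^ 2 * y⁻¹)) = M.noiseLevel n := by field_simp
    have e2 : M.noiseLevel n * (z⁻¹ * (z ^ 2 * z⁻¹)) = M.noiseLevel n := by field_simp
    rw [abs_le] at h1 h2 ⊢
    obtain ⟨h11, h12⟩ := h1
    obtain ⟨h21, h22⟩ := h2
    ring_nf at h11 h12 h21 h22 e1 e2 ⊢
    constructor <;> linarith
  rw [abs_mul, abs_mul, abs_of_pos (show (0:ℝ) < 4 by norm_num),
    abs_of_pos (show 0 < y⁻¹ * z⁻¹ by positivity)] at key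
  have key2 : |b - b'| * (y⁻¹ * z⁻¹) ≤ 8 * M.noiseLevel n := by linarith
  calc |b - b'| = |b - b'| * (y⁻¹ * z⁻¹) * (y * z) := by field_simp
    _ ≤ _ := by gcongr

end SpikedModel

end SparsePCA

namespace SparsePCA

open Matrix

/-! ### Eigenvalues of the selected submatrix -/

/-- Extension by zero of a vector indexed by a set of coordinates. -/
noncomputable def extendZero {p : ℕ} {B : Finset (Fin p)} (x : {ν // ν ∈ B} → ℝ) : Fin p → ℝ :=
  fun ν => if h : ν ∈ B then x ⟨ν, h⟩ else 0

lemma dotProduct_extendZero {p : ℕ} {B : Finset (Fin p)} (y : Fin p → ℝ) (x : {ν // ν ∈ B} → ℝ) :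
    y ⬝ᵥ extendZero x = (fun b : {ν // ν ∈ B} => y b) ⬝ᵥ x := by
  simp only [dotProduct]
  rw [← Finset.sum_subset (Finset.subset_univ B), ← Finset.sum_coe_sort B]
  · refine Finset.sum_congr rfl fun b _ => ?_
    simp [extendZero, b.2]
  · intro ν _ hν
    simp [extendZero, hν]

lemma extendZero_dotProduct_self {p : ℕ} {B : Finset (Fin p)} (x : {ν // ν ∈ B} → ℝ) :
    extendZero x ⬝ᵥ extendZero x = x ⬝ᵥ x := by
  rw [dotProduct_extendZero]
  congr 1
  ext b
  simp [extendZero]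

lemma extendZero_of_notMem {p : ℕ} {B : Finset (Fin p)} (x : {ν // ν ∈ B} → ℝ) {ν : Fin p}
    (hν : ν ∉ B) : extendZero x ν = 0 := by
  simp [extendZero, hν]

lemma dotProduct_submatrix_mulVec {p : ℕ} {B : Finset (Fin p)} (A : Matrix (Fin p) (Fin p) ℝ)
    (x : {ν // ν ∈ B} → ℝ) :
    x ⬝ᵥ A.submatrix Subtype.val Subtype.val *ᵥ x = extendZero x ⬝ᵥ A *ᵥ extendZero x := by
  rw [dotProduct_comm (extendZero x), dotProduct_extendZero, dotProduct_comm]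
  congr 1
  ext b
  exact (dotProduct_extendZero (A b) x).symm

/-- On vectors supported in `B`, an entrywise bound by `ε √(C ν ν) √(C μ μ)` bounds the quadratic
form by `ε` times the trace of `C` over `B`. The rank of the spiked part thus replaces the size of
`B` where the variances are large. -/
lemma abs_quadForm_sub_le {p : ℕ} {B : Finset (Fin p)} {S C : Matrix (Fin p) (Fin p) ℝ} {ε : ℝ}
    (hC : ∀ ν, 0 ≤ C ν ν)
    (h : ∀ ν μ, |S ν μ - C ν μ| ≤ ε * (√(C ν ν) * √(C μ μ))) (hε : 0 ≤ ε) (y : Fin p → ℝ)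
    (hy : ∀ ν ∉ B, y ν = 0) :
    |y ⬝ᵥ S *ᵥ y - y ⬝ᵥ C *ᵥ y| ≤ ε * (∑ ν ∈ B, C ν ν) * (y ⬝ᵥ y) := by
  have e1 : y ⬝ᵥ S *ᵥ y - y ⬝ᵥ C *ᵥ y = ∑ ν, ∑ μ, y ν * (S ν μ - C ν μ) * y μ := by
    simp only [dotProduct, mulVec, Finset.mul_sum, ← Finset.sum_sub_distrib]
    refine Finset.sum_congr rfl fun ν _ => Finset.sum_congr rfl fun μ _ => by ring
  have e2 : y ⬝ᵥ y = ∑ ν ∈ B, |y ν| ^ 2 := by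
    simp only [dotProduct, sq, abs_mul_abs_self]
    refine (Finset.sum_subset (Finset.subset_univ B) ?_).symm
    intro ν _ hν; simp [hy ν hν]
  have e3 : ∑ ν, |y ν| * √(C ν ν) = ∑ ν ∈ B, |y ν| * √(C ν ν) := by
    refine (Finset.sum_subset (Finset.subset_univ B) ?_).symm
    intro ν _ hν; simp [hy ν hν]
  calc |y ⬝ᵥ S *ᵥ y - y ⬝ᵥ C *ᵥ y| ≤ ∑ ν, ∑ μ, |y ν * (S ν μ - C ν μ) * y μ| := by
        rw [e1]
        refine (Finset.abs_sum_le_sum_abs _ _).trans (Finset.sum_le_sum fun ν _ => ?_)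
        exact Finset.abs_sum_le_sum_abs _ _
    _ ≤ ∑ ν, ∑ μ, ε * ((|y ν| * √(C ν ν)) * (|y μ| * √(C μ μ))) := by
        refine Finset.sum_le_sum fun ν _ => Finset.sum_le_sum fun μ _ => ?_
        rw [abs_mul, abs_mul]
        calc |y ν| * |S ν μ - C ν μ| * |y μ|
            ≤ |y ν| * (ε * (√(C ν ν) * √(C μ μ))) * |y μ| := by
              gcongr; exact h ν μ
          _ = _ := by ring
    _ = ε * (∑ ν ∈ B, |y ν| * √(C ν ν)) ^ 2 := by
        rw [sq, ← e3, Finset.sum_mul_sum, Finset.mul_sum]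
        simp only [Finset.mul_sum]
    _ ≤ ε * ((∑ ν ∈ B, |y ν| ^ 2) * ∑ ν ∈ B, √(C ν ν) ^ 2) := by
        gcongr
        exact Finset.sum_mul_sq_le_sq_mul_sq B _ _
    _ = _ := by
        rw [e2, Finset.sum_congr rfl fun ν _ => Real.sq_sqrt (hC ν)]; ring

namespace SpikedModel

variable {mbar : ℕ} (M : SpikedModel mbar)

lemma inner_q (n : ℕ) (j : Fin mbar) (y : Fin (M.p n) → ℝ) :
    inner ℝ (M.q n j) (WithLp.toLp 2 y) = (M.q n j).ofLp ⬝ᵥ y := by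
  simp [PiLp.inner_apply, dotProduct, mul_comm]

lemma q_dotProduct_q (n : ℕ) (i j : Fin mbar) :
    (M.q n i).ofLp ⬝ᵥ (M.q n j).ofLp = if i = j then 1 else 0 := by
  rw [← inner_q]
  exact orthonormal_iff_ite.1 (M.orthonormal n) i j

lemma sum_sq_dotProduct_q_le (n : ℕ) (y : Fin (M.p n) → ℝ) :
    ∑ j, ((M.q n j).ofLp ⬝ᵥ y) ^ 2 ≤ y ⬝ᵥ y := by
  have h := (M.orthonormal n).sum_inner_products_le (WithLp.toLp 2 y) (s := Finset.univ)
  simp only [inner_q, Real.norm_eq_abs, sq_abs, EuclideanSpace.norm_sq_eq] at h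
  simpa [dotProduct, sq] using h

lemma sum_sq_q_le_one (n : ℕ) (j : Fin mbar) (B : Finset (Fin (M.p n))) :
    ∑ ν ∈ B, M.q n j ν ^ 2 ≤ 1 := by
  have h := M.q_dotProduct_q n j j
  simp only [if_true, dotProduct, ← sq] at h
  rw [← h]
  exact Finset.sum_le_univ_sum_of_nonneg fun ν => sq_nonneg _

lemma spike_succ (n : ℕ) (j : Fin mbar) : M.spike n (j + 1) = M.lam n j ^ 2 := by
  simp [spike]

lemma spike_nonneg (n j : ℕ) : 0 ≤ M.spike n j := by
  unfold spike; split_ifs <;> positivity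

lemma spike_pos (n : ℕ) {j : ℕ} (h1 : 1 ≤ j) (h2 : j ≤ mbar) : 0 < M.spike n j := by
  unfold spike
  rw [dif_pos ⟨h1, h2⟩]
  exact pow_pos (M.lam_pos n _) 2

lemma spike_anti (n : ℕ) {i j : ℕ} (hi : 1 ≤ i) (hij : i ≤ j) : M.spike n j ≤ M.spike n i := by
  by_cases hj : j ≤ mbar
  · unfold spike
    rw [dif_pos ⟨hi.trans hij, hj⟩, dif_pos ⟨hi, hij.trans hj⟩]
    refine pow_le_pow_left₀ (M.lam_pos n _).le (M.lam_antitone n ?_) 2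
    rw [Fin.mk_le_mk]; omega
  · have : M.spike n j = 0 := by
      unfold spike; rw [dif_neg]; omega
    rw [this]; exact M.spike_nonneg n i

lemma sq_lam_le_spike_one (n : ℕ) (j : Fin mbar) : M.lam n j ^ 2 ≤ M.spike n 1 := by
  rw [← spike_succ]; exact M.spike_anti n le_rfl (by omega)

lemma sum_cov_apply_self_le (n : ℕ) (B : Finset (Fin (M.p n))) :
    ∑ ν ∈ B, M.cov n ν ν ≤ B.card + mbar * M.spike n 1 := by
  simp only [cov_apply_self, Finset.sum_add_distrib]
  gcongr
  · simp
  rw [Finset.sum_comm]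
  calc ∑ j, ∑ ν ∈ B, M.lam n j ^ 2 * M.q n j ν ^ 2 ≤ ∑ j : Fin mbar, M.spike n 1 := by
        refine Finset.sum_le_sum fun j _ => ?_
        rw [← Finset.mul_sum]
        calc _ ≤ M.lam n j ^ 2 * 1 := by gcongr; exact M.sum_sq_q_le_one n j B
          _ ≤ _ := by rw [mul_one]; exact M.sq_lam_le_spike_one n j
    _ = _ := by simp

/-- Upper bound for the population form on the orthogonal complement of the leading
eigenvectors; it does not depend on how much of them `B` retains. -/
lemma quadForm_cov_le (n k : ℕ) (y : Fin (M.p n) → ℝ)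
    (hy : ∀ j : Fin mbar, (j : ℕ) < k → (M.q n j).ofLp ⬝ᵥ y = 0) :
    y ⬝ᵥ M.cov n *ᵥ y ≤ (1 + M.spike n (k + 1)) * (y ⬝ᵥ y) := by
  rw [dotProduct_cov_mulVec, add_mul, one_mul]
  gcongr
  calc ∑ j, M.lam n j ^ 2 * (((M.q n j).ofLp ⬝ᵥ y) * ((M.q n j).ofLp ⬝ᵥ y))
      ≤ ∑ j, M.spike n (k + 1) * ((M.q n j).ofLp ⬝ᵥ y) ^ 2 := by
        refine Finset.sum_le_sum fun j _ => ?_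
        by_cases hj : (j : ℕ) < k
        · simp [hy j hj]
        · rw [← sq, ← spike_succ]
          gcongr
          exact M.spike_anti n (by omega) (by omega)
    _ ≤ _ := by
        rw [← Finset.mul_sum]
        gcongr
        · exact M.spike_nonneg _ _
        · exact M.sum_sq_dotProduct_q_le n y

/-- Lower bound for the population form on the truncations to `B` of the span of the leading
eigenvectors, when `B` carries most of their mass. -/
lemma quadForm_cov_ge (n : ℕ) {k : ℕ} (hk : k < mbar) {B : Finset (Fin (M.p n))} {η : ℝ}
    (hη : ∀ j, ∑ ν ∈ Bᶜ, M.q n j ν ^ 2 ≤ η) (z : Fin (k + 1) → ℝ) (y : Fin (M.p n) → ℝ)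
    (hyB : ∀ ν ∉ B, y ν = 0)
    (hy : ∀ ν ∈ B, y ν = ∑ i, z i * M.q n (Fin.castLE hk i) ν) (hη1 : mbar * η < 1) :
    (1 - mbar * η) * ∑ i, z i ^ 2 ≤ y ⬝ᵥ y ∧
    (1 + (1 - mbar * η) * M.spike n (k + 1)) * (y ⬝ᵥ y) ≤ y ⬝ᵥ M.cov n *ᵥ y := by
  set c : Fin (k + 1) → Fin mbar := Fin.castLE hk with hc
  set w : Fin (M.p n) → ℝ := ∑ i, z i • (M.q n (c i)).ofLp with hw
  have hwν : ∀ ν, w ν = ∑ i, z i * M.q n (c i) ν := fun ν => by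
    simp [hw, Finset.sum_apply]
  have hcinj : Function.Injective c := Fin.castLE_injective hk
  have hww : w ⬝ᵥ w = ∑ i, z i ^ 2 := by
    rw [hw, sum_dotProduct]
    refine Finset.sum_congr rfl fun i _ => ?_
    rw [dotProduct_sum, Finset.sum_eq_single i]
    · rw [smul_dotProduct, dotProduct_smul, q_dotProduct_q]; simp [sq]
    · intro j _ hj
      rw [smul_dotProduct, dotProduct_smul, q_dotProduct_q, if_neg fun h => hj (hcinj h).symm]
      simp
    · simp
  -- `y` is the truncation of `w`; hence `w ⬝ᵥ y = y ⬝ᵥ y`, and Cauchy–Schwarz bounds the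
  -- coefficients of `y` along the `q_j` from below
  have hwy : w ⬝ᵥ y = y ⬝ᵥ y := by
    refine Finset.sum_congr rfl fun ν _ => ?_
    by_cases hν : ν ∈ B
    · rw [hwν, hy ν hν]
    · simp [hyB ν hν]
  have hsplit : w ⬝ᵥ w = y ⬝ᵥ y + ∑ ν ∈ Bᶜ, w ν ^ 2 := by
    have e : y ⬝ᵥ y = ∑ ν ∈ B, w ν ^ 2 := by
      rw [dotProduct, ← Finset.sum_subset (Finset.subset_univ B)]
      · refine Finset.sum_congr rfl fun ν hν => ?_
        rw [hy ν hν, hwν, sq]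
      · intro ν _ hν; simp [hyB ν hν]
    rw [e, Finset.sum_add_sum_compl, dotProduct]
    simp only [sq]
  have hout : ∑ ν ∈ Bᶜ, w ν ^ 2 ≤ mbar * η * ∑ i, z i ^ 2 := by
    calc ∑ ν ∈ Bᶜ, w ν ^ 2
        ≤ ∑ ν ∈ Bᶜ, (∑ i, z i ^ 2) * ∑ j, M.q n j ν ^ 2 := by
          refine Finset.sum_le_sum fun ν _ => ?_
          rw [hwν]
          refine (Finset.sum_mul_sq_le_sq_mul_sq Finset.univ _ _).trans ?_
          gcongr
          rw [← Finset.sum_image (s := Finset.univ) (g := c) (f := fun j => M.q n j ν ^ 2)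
            hcinj.injOn]
          exact Finset.sum_le_univ_sum_of_nonneg fun ν => sq_nonneg _
      _ = (∑ i, z i ^ 2) * ∑ j, ∑ ν ∈ Bᶜ, M.q n j ν ^ 2 := by
          rw [← Finset.mul_sum, Finset.sum_comm]
      _ ≤ (∑ i, z i ^ 2) * ∑ j : Fin mbar, η := by
          gcongr with j; exact hη j
      _ = _ := by simp; ring
  have hyy : (1 - mbar * η) * ∑ i, z i ^ 2 ≤ y ⬝ᵥ y := by
    rw [← hww] at hout ⊢; linarith
  refine ⟨hyy, ?_⟩
  set Q := ∑ i, ((M.q n (c i)).ofLp ⬝ᵥ y) ^ 2 with hQ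
  have hQ0 : 0 ≤ Q := by positivity
  have hCS : (y ⬝ᵥ y) ^ 2 ≤ (∑ i, z i ^ 2) * Q := by
    have e : y ⬝ᵥ y = ∑ i, z i * ((M.q n (c i)).ofLp ⬝ᵥ y) := by
      rw [← hwy, hw, sum_dotProduct]
      simp only [smul_dotProduct, smul_eq_mul]
    rw [e]
    exact Finset.sum_mul_sq_le_sq_mul_sq _ _ _
  have hyy0 : 0 ≤ y ⬝ᵥ y := Finset.sum_nonneg fun i _ => mul_self_nonneg (y i)
  have hQy : (1 - mbar * η) * (y ⬝ᵥ y) ≤ Q := by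
    rcases hyy0.eq_or_lt with h0 | hpos
    · rw [← h0]; simpa using hQ0
    · have h1 : ((1 - mbar * η) * (y ⬝ᵥ y)) * (y ⬝ᵥ y) ≤ Q * (y ⬝ᵥ y) := by
        nlinarith [mul_le_mul_of_nonneg_left hCS (show 0 ≤ 1 - mbar * η by linarith),
          mul_le_mul_of_nonneg_right hyy hQ0]
      exact le_of_mul_le_mul_right h1 hpos
  have hsum : M.spike n (k + 1) * Q ≤
      ∑ j, M.lam n j ^ 2 * (((M.q n j).ofLp ⬝ᵥ y) * ((M.q n j).ofLp ⬝ᵥ y)) := by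
    calc M.spike n (k + 1) * Q
        ≤ ∑ i, M.lam n (c i) ^ 2 * (((M.q n (c i)).ofLp ⬝ᵥ y) * ((M.q n (c i)).ofLp ⬝ᵥ y)) := by
          rw [hQ, Finset.mul_sum]
          refine Finset.sum_le_sum fun i _ => ?_
          rw [← sq, ← spike_succ]
          gcongr
          exact M.spike_anti n (by omega) (by
            have := i.isLt
            simp only [hc, Fin.val_castLE]; omega)
      _ = ∑ j ∈ Finset.univ.image c,
            M.lam n j ^ 2 * (((M.q n j).ofLp ⬝ᵥ y) * ((M.q n j).ofLp ⬝ᵥ y)) := by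
          rw [Finset.sum_image hcinj.injOn]
      _ ≤ _ := Finset.sum_le_univ_sum_of_nonneg fun j =>
          mul_nonneg (sq_nonneg _) (mul_self_nonneg _)
  rw [dotProduct_cov_mulVec]
  have := mul_le_mul_of_nonneg_left hQy (M.spike_nonneg n (k + 1))
  linarith

/-- Deterministic perturbation bound for the selected sample eigenvalues, in terms of the entrywise
error `ε` and of the squared mass `η` of the eigenvectors outside the selected coordinates. -/
lemma abs_ellB_sub_le {n : ℕ} (x : Fin n → EuclideanSpace ℝ (Fin (M.p n))) {α ε η : ℝ}
    (hε : 0 ≤ ε)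
    (hent : ∀ ν μ, |sampleCov x ν μ - M.cov n ν μ| ≤ ε * (√(M.cov n ν ν) * √(M.cov n μ μ)))
    (hη0 : 0 ≤ η) (hη1 : mbar * η < 1)
    (hη : ∀ j, ∑ ν ∈ (selected α x)ᶜ, M.q n j ν ^ 2 ≤ η) {j : ℕ} (hj : 1 ≤ j)
    (hj' : j ≤ mbar + 1) :
    |ellB α x j - 1 - M.spike n j| ≤
      mbar * η * M.spike n j + ε * ((selected α x).card + mbar * M.spike n 1) := by
  obtain ⟨k, rfl⟩ : ∃ k, j = k + 1 := ⟨j - 1, by omega⟩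
  set B := selected α x with hB
  set δ := ε * (B.card + mbar * M.spike n 1) with hδ
  have hsp1 := M.spike_nonneg n 1
  have hspk := M.spike_nonneg n (k + 1)
  have hδ0 : 0 ≤ δ := by positivity
  have hnoise : ∀ y : {ν // ν ∈ B} → ℝ,
      |extendZero y ⬝ᵥ sampleCov x *ᵥ extendZero y -
        extendZero y ⬝ᵥ M.cov n *ᵥ extendZero y| ≤ δ * (y ⬝ᵥ y) := by
    intro y
    refine (abs_quadForm_sub_le (B := B) (fun ν => zero_le_one.trans (M.one_le_cov_apply_self n ν))
      hent hε _ fun ν hν => extendZero_of_notMem y hν).trans ?_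
    rw [extendZero_dotProduct_self]
    have : 0 ≤ y ⬝ᵥ y := Finset.sum_nonneg fun i _ => mul_self_nonneg (y i)
    gcongr
    rw [hδ]
    gcongr
    exact M.sum_cov_apply_self_le n B
  have hup : eval ((sampleCov x).submatrix (Subtype.val : {ν // ν ∈ B} → _) Subtype.val) (k + 1) ≤
      1 + M.spike n (k + 1) + δ := by
    refine eval_le_of_orthogonal
      (fun (i : Fin k) (b : {ν // ν ∈ B}) => M.q n ⟨i, by omega⟩ b) (by positivity) fun y hy => ?_
    rw [dotProduct_submatrix_mulVec]
    have h1 := (abs_le.1 (hnoise y)).2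
    have h2 := M.quadForm_cov_le n k (extendZero y) fun j hj => by
      rw [dotProduct_extendZero]
      exact hy ⟨j, hj⟩
    rw [extendZero_dotProduct_self] at h2
    linarith
  have hlo : k + 1 ≤ mbar → 1 + (1 - mbar * η) * M.spike n (k + 1) - δ ≤
      eval ((sampleCov x).submatrix (Subtype.val : {ν // ν ∈ B} → _) Subtype.val) (k + 1) := by
    intro hk
    set f : Fin (k + 1) → {ν // ν ∈ B} → ℝ := fun i b => M.q n (Fin.castLE hk i) b with hf
    have hz : ∀ z : Fin (k + 1) → ℝ, _ := fun z =>
      M.quadForm_cov_ge n hk hη z (extendZero (∑ i, z i • f i))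
        (fun ν hν => extendZero_of_notMem _ hν)
        (fun ν hν => by simp [extendZero, hν, hf, Finset.sum_apply]) hη1
    refine le_eval_of_linearIndependent ((sampleCov_isHermitian x).submatrix _) f ?_ fun z => ?_
    · rw [Fintype.linearIndependent_iff]
      intro z h0
      have h1 := (hz z).1
      rw [extendZero_dotProduct_self, h0, zero_dotProduct] at h1
      have h2 : ∑ i, z i ^ 2 ≤ 0 := by
        by_contra! hpos
        exact absurd h1 (not_le.2 (mul_pos (by linarith) hpos))
      have h3 := (Finset.sum_eq_zero_iff_of_nonneg fun i _ => sq_nonneg (z i)).1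
        (le_antisymm h2 (Finset.sum_nonneg fun i _ => sq_nonneg (z i)))
      intro i
      simpa using h3 i (Finset.mem_univ i)
    · rw [dotProduct_submatrix_mulVec]
      have h1 := (abs_le.1 (hnoise (∑ i, z i • f i))).1
      have h2 := (hz z).2
      rw [extendZero_dotProduct_self] at h2
      linarith
  have hmη : 0 ≤ mbar * η * M.spike n (k + 1) := by positivity
  change |max (eval ((sampleCov x).submatrix (Subtype.val : {ν // ν ∈ B} → _) Subtype.val)
    (k + 1)) 1 - 1 - M.spike n (k + 1)| ≤ _
  rw [abs_le]
  constructor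
  · by_cases hk : k + 1 ≤ mbar
    · have := (hlo hk).trans (le_max_left _ 1)
      linarith
    · have h0 : M.spike n (k + 1) = 0 := by
        unfold spike; rw [dif_neg]; omega
      have := le_max_right (eval ((sampleCov x).submatrix
        (Subtype.val : {ν // ν ∈ B} → _) Subtype.val) (k + 1)) 1
      rw [h0] at hmη ⊢
      linarith
  · have := max_le hup (show (1 : ℝ) ≤ 1 + M.spike n (k + 1) + δ by linarith)
    linarith

end SpikedModel

/-! ### The selected coordinates -/

lemma div_sqrt_mul_rpow {s c t r : ℝ} (hs : 0 ≤ s) (hc : 0 < c) (ht : 0 < t) :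
    (s / √(c * t)) ^ r = s ^ r * c ^ (-r / 2) * t ^ (-r / 2) := by
  rw [Real.div_rpow hs (Real.sqrt_nonneg _), Real.sqrt_eq_rpow, ← Real.rpow_mul (by positivity),
    Real.mul_rpow hc.le ht.le, div_eq_mul_inv, mul_inv, ← Real.rpow_neg hc.le,
    ← Real.rpow_neg ht.le, mul_assoc]
  ring_nf

namespace SpikedModel

variable {mbar : ℕ} (M : SpikedModel mbar)

lemma mem_selected_iff {n : ℕ} (x : Fin n → EuclideanSpace ℝ (Fin (M.p n))) {α : ℝ}
    (ν : Fin (M.p n)) :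
    ν ∈ selected α x ↔ 1 + α * M.noiseLevel n ≤ sampleCov x ν ν := by
  simp [selected, noiseLevel, pmax]

/-- The noise level relative to the `j`-th spike. -/
noncomputable def relNoise (j : Fin mbar) (n : ℕ) : ℝ := M.noiseLevel n / M.lam n j ^ 2

lemma relNoise_pos (j : Fin mbar) {n : ℕ} (hn : 2 ≤ n) : 0 < M.relNoise j n :=
  div_pos (M.noiseLevel_pos hn) (pow_pos (M.lam_pos n j) 2)

/-- The quantity that the sparsity condition forces to vanish, written with `relNoise`. -/
noncomputable def sparsityRate (r : ℝ) (s : ℕ → Fin mbar → ℝ) (j : Fin mbar) (n : ℕ) : ℝ :=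
  s n j ^ r * M.relNoise j n ^ (1 - r / 2)

/-- A selected coordinate carries signal of the order of the noise level: this uses `d < α`. -/
lemma noiseLevel_le_of_mem_selected {n : ℕ} {x : Fin n → EuclideanSpace ℝ (Fin (M.p n))} {α d : ℝ}
    (hdα : d < α) (hd1 : d * M.noiseLevel n ≤ 1)
    (hdiag : ∀ ν, |sampleCov x ν ν - M.cov n ν ν| ≤ d * M.noiseLevel n * M.cov n ν ν)
    {ν : Fin (M.p n)} (hν : ν ∈ selected α x) :
    (α - d) / 2 * M.noiseLevel n ≤ ∑ j, M.lam n j ^ 2 * M.q n j ν ^ 2 := by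
  rw [mem_selected_iff] at hν
  have h1 := (abs_le.1 (hdiag ν)).2
  have h2 := M.one_le_cov_apply_self n ν
  rw [cov_apply_self] at h1 h2
  have h3 := M.noiseLevel_nonneg n
  have h4 : 0 ≤ (α - d) * M.noiseLevel n := mul_nonneg (by linarith) h3
  nlinarith

lemma le_noiseLevel_of_notMem_selected {n : ℕ} {x : Fin n → EuclideanSpace ℝ (Fin (M.p n))}
    {α d : ℝ} (hd1 : d * M.noiseLevel n ≤ 1 / 2)
    (hdiag : ∀ ν, |sampleCov x ν ν - M.cov n ν ν| ≤ d * M.noiseLevel n * M.cov n ν ν)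
    {ν : Fin (M.p n)} (hν : ν ∉ selected α x) :
    ∑ j, M.lam n j ^ 2 * M.q n j ν ^ 2 ≤ 2 * (α + d) * M.noiseLevel n := by
  rw [mem_selected_iff, not_le] at hν
  have h1 := (abs_le.1 (hdiag ν)).1
  have h2 := M.one_le_cov_apply_self n ν
  rw [cov_apply_self] at h1 h2
  have h3 := M.noiseLevel_nonneg n
  nlinarith

/-- Few coordinates are selected. -/
lemma card_selected_mul_noiseLevel_le (hmbar : 1 ≤ mbar) {r : ℝ} (hr : 0 < r)
    {s : ℕ → Fin mbar → ℝ} (hs : ∀ n j, WeakLr r (s n j) (M.q n j)) {n : ℕ} (hn : 2 ≤ n)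
    (hs0 : ∀ j, 0 ≤ s n j) {x : Fin n → EuclideanSpace ℝ (Fin (M.p n))} {α d : ℝ}
    (hdα : d < α) (hd1 : d * M.noiseLevel n ≤ 1)
    (hdiag : ∀ ν, |sampleCov x ν ν - M.cov n ν ν| ≤ d * M.noiseLevel n * M.cov n ν ν) :
    (selected α x).card * M.noiseLevel n ≤
      ((α - d) / (2 * mbar)) ^ (-r / 2) * (∑ j, M.sparsityRate r s j n) * M.spike n 1 := by
  set c := (α - d) / (2 * mbar) with hc
  have hm : (0 : ℝ) < mbar := by exact_mod_cast (by omega : 0 < mbar)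
  have hc0 : 0 < c := div_pos (by linarith) (by positivity)
  have hτ := M.noiseLevel_pos hn
  set T : Fin mbar → Finset (Fin (M.p n)) := fun j =>
    Finset.univ.filter fun ν => √(c * M.relNoise j n) ≤ |M.q n j ν| with hT
  have hsub : selected α x ⊆ Finset.univ.biUnion T := by
    intro ν hν
    have h1 := M.noiseLevel_le_of_mem_selected hdα hd1 hdiag hν
    by_contra hcon
    simp only [Finset.mem_biUnion, Finset.mem_univ, true_and, hT, Finset.mem_filter, not_exists,
      not_le] at hcon
    have h2 : ∑ j, M.lam n j ^ 2 * M.q n j ν ^ 2 < ∑ j : Fin mbar, c * M.noiseLevel n := by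
      refine Finset.sum_lt_sum_of_nonempty ⟨⟨0, by omega⟩, Finset.mem_univ _⟩ fun j _ => ?_
      have hl := pow_pos (M.lam_pos n j) 2
      have h3 : M.q n j ν ^ 2 < c * M.relNoise j n := by
        have := hcon j
        rwa [Real.lt_sqrt (abs_nonneg _), sq_abs] at this
      calc M.lam n j ^ 2 * M.q n j ν ^ 2 < M.lam n j ^ 2 * (c * M.relNoise j n) := by gcongr
        _ = c * M.noiseLevel n := by
            rw [relNoise]; field_simp [(M.lam_pos n j).ne']
    have h4 : ∑ j : Fin mbar, c * M.noiseLevel n = (α - d) / 2 * M.noiseLevel n := by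
      rw [Finset.sum_const, Finset.card_univ, Fintype.card_fin, nsmul_eq_mul, hc]
      field_simp
    linarith
  have hcard : ((selected α x).card : ℝ) ≤ ∑ j, (s n j / √(c * M.relNoise j n)) ^ r := by
    calc ((selected α x).card : ℝ) ≤ ((Finset.univ.biUnion T).card : ℝ) := by
          exact_mod_cast Finset.card_le_card hsub
      _ ≤ ∑ j, ((T j).card : ℝ) := by exact_mod_cast Finset.card_biUnion_le
      _ ≤ _ := Finset.sum_le_sum fun j _ => (hs n j).card_le hr
          (Real.sqrt_pos.2 (mul_pos hc0 (M.relNoise_pos j hn))) (hs0 j)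
  calc _ ≤ (∑ j, (s n j / √(c * M.relNoise j n)) ^ r) * M.noiseLevel n := by gcongr
    _ = ∑ j, c ^ (-r / 2) * M.sparsityRate r s j n * M.lam n j ^ 2 := by
        rw [Finset.sum_mul]
        refine Finset.sum_congr rfl fun j _ => ?_
        have hθ := M.relNoise_pos j hn
        have e1 : M.noiseLevel n = M.relNoise j n * M.lam n j ^ 2 := by
          rw [relNoise]; field_simp [(M.lam_pos n j).ne']
        have e2 : M.relNoise j n ^ (1 - r / 2) =
            M.relNoise j n * M.relNoise j n ^ (-r / 2) := by
          rw [show 1 - r / 2 = 1 + -r / 2 by ring, Real.rpow_add hθ, Real.rpow_one]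
        rw [div_sqrt_mul_rpow (hs0 j) hc0 hθ, sparsityRate, e2]
        conv_lhs => rw [e1]
        ring
    _ ≤ ∑ j, c ^ (-r / 2) * M.sparsityRate r s j n * M.spike n 1 := by
        refine Finset.sum_le_sum fun j _ => ?_
        have hθ := M.relNoise_pos j hn
        have : 0 ≤ M.sparsityRate r s j n :=
          mul_nonneg (Real.rpow_nonneg (hs0 j) _) (by positivity)
        gcongr
        exact M.sq_lam_le_spike_one n j
    _ = _ := by rw [Finset.mul_sum, Finset.sum_mul]

/-- The eigenvectors carry little mass outside the selected coordinates. -/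
lemma sum_sq_notMem_selected_le {r : ℝ} (hr : 0 < r) (hr2 : r < 2)
    {s : ℕ → Fin mbar → ℝ} (hs : ∀ n j, WeakLr r (s n j) (M.q n j)) {n : ℕ} (hn : 2 ≤ n)
    (hs0 : ∀ j, 0 < s n j) {x : Fin n → EuclideanSpace ℝ (Fin (M.p n))} {α d : ℝ}
    (hα : 0 < α) (hd : 0 ≤ d) (hd1 : d * M.noiseLevel n ≤ 1 / 2)
    (hdiag : ∀ ν, |sampleCov x ν ν - M.cov n ν ν| ≤ d * M.noiseLevel n * M.cov n ν ν)
    (j : Fin mbar) :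
    ∑ ν ∈ (selected α x)ᶜ, M.q n j ν ^ 2 ≤
      (2 * (α + d)) ^ (1 - r / 2) * (1 + 1 / (2 / r - 1)) * M.sparsityRate r s j n +
        2 * (α + d) * M.relNoise j n := by
  set c := 2 * (α + d) with hc
  have hc0 : 0 < c := by positivity
  have hθ := M.relNoise_pos j hn
  have hl := pow_pos (M.lam_pos n j) 2
  refine ((hs n j).sum_sq_le hr hr2 (a := √(c * M.relNoise j n)) (Real.sqrt_pos.2 (by positivity))
    (hs0 j) _ fun ν hν => ?_).trans (le_of_eq ?_)
  · rw [Finset.mem_compl] at hν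
    have h1 := M.le_noiseLevel_of_notMem_selected hd1 hdiag hν
    have h2 : M.lam n j ^ 2 * M.q n j ν ^ 2 ≤ c * M.noiseLevel n :=
      (Finset.single_le_sum (f := fun j => M.lam n j ^ 2 * M.q n j ν ^ 2)
        (fun i _ => by positivity) (Finset.mem_univ j)).trans h1
    refine Real.le_sqrt_of_sq_le ?_
    rw [sq_abs, relNoise, ← mul_div_assoc, le_div_iff₀ hl]
    linarith
  · rw [Real.sq_sqrt (by positivity), div_sqrt_mul_rpow (hs0 j).le hc0 hθ, sparsityRate,
      show 1 - r / 2 = 1 + -r / 2 by ring, Real.rpow_add hθ, Real.rpow_add hc0, Real.rpow_one,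
      Real.rpow_one]
    ring

/-! ### Vanishing rates -/

lemma GR.tendsto_noiseLevel {M : SpikedModel mbar} {r : ℝ} (h : M.GR r) :
    Tendsto M.noiseLevel atTop (𝓝 0) := by
  have h1 : Tendsto (fun n => Real.log (M.p n) / n) atTop (𝓝 0) :=
    (isLittleO_one_iff ℝ).1 h.dim
  have h2 : Tendsto (fun n : ℕ => Real.log n / n) atTop (𝓝 0) :=
    (Real.isLittleO_log_id_atTop.comp_tendsto tendsto_natCast_atTop_atTop).tendsto_div_nhds_zero
  have h3 : Tendsto (fun n => Real.log (M.pmax n) / n) atTop (𝓝 0) := by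
    have h12 := h1.add h2
    rw [add_zero] at h12
    refine squeeze_zero' ?_ ?_ h12
    · filter_upwards [eventually_ge_atTop 1] with n hn
      exact div_nonneg (Real.log_nonneg (M.one_le_pmax hn)) (Nat.cast_nonneg n)
    · filter_upwards [eventually_ge_atTop 1] with n hn
      rw [← add_div]
      gcongr
      have hlp : 0 ≤ Real.log (M.p n) := Real.log_natCast_nonneg _
      have hln : 0 ≤ Real.log (n : ℝ) := Real.log_natCast_nonneg _
      -- `Real.log 0 = 0`, so the bound holds without a lower bound on the dimension
      rcases max_choice (M.p n) n with h | h <;> rw [pmax, h] <;> linarith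
  have := (Real.continuous_sqrt.tendsto 0).comp h3
  rwa [Real.sqrt_zero] at this

lemma GR.tendsto_relNoise {M : SpikedModel mbar} {r : ℝ} (h : M.GR r) (j : Fin mbar) :
    Tendsto (M.relNoise j) atTop (𝓝 0) := by
  have h1 := h.smallest.tendsto_div_nhds_zero
  have h2 := (Real.continuous_sqrt.tendsto 0).comp h1
  rw [Real.sqrt_zero] at h2
  refine squeeze_zero' (Eventually.of_forall fun n =>
    div_nonneg (M.noiseLevel_nonneg n) (sq_nonneg _)) ?_ h2
  filter_upwards with n
  have hj := j.isLt
  have hm := M.spike_pos n (j := mbar) (by omega) le_rfl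
  have e : Real.log (M.pmax n) / (n * M.spike n mbar ^ 2) =
      Real.log (M.pmax n) / n / M.spike n mbar ^ 2 := by rw [div_div]
  rw [Function.comp_apply, e, Real.sqrt_div' _ (sq_nonneg _), Real.sqrt_sq hm.le]
  refine div_le_div_of_nonneg_left (M.noiseLevel_nonneg n) hm ?_
  rw [← spike_succ]
  exact M.spike_anti n (by omega) (by omega)

lemma SP.tendsto_sparsityRate {M : SpikedModel mbar} {r : ℝ} {s : ℕ → Fin mbar → ℝ}
    (h : M.SP r s) (j : Fin mbar) : Tendsto (M.sparsityRate r s j) atTop (𝓝 0) := by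
  have h1 : (fun n => min 1 (M.spike n 1 ^ 2)) =O[atTop] (fun _ => (1 : ℝ)) := by
    refine isBigO_of_le _ fun n => ?_
    rw [Real.norm_of_nonneg (by positivity), norm_one]
    exact min_le_left _ _
  have h2 := (isLittleO_one_iff ℝ).1 ((h.rate j).trans_isBigO h1)
  refine h2.congr' ?_
  filter_upwards [eventually_ge_atTop 1] with n hn
  have hl := M.lam_pos n j
  have hn0 : (0 : ℝ) < n := by exact_mod_cast (by omega : 0 < n)
  have h3 : Real.log (M.pmax n) / (n * M.lam n j ^ 4) = M.relNoise j n ^ (2 : ℝ) := by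
    rw [Real.rpow_two, relNoise, div_pow, ← M.mul_noiseLevel_sq hn]
    field_simp
  have h4 : 0 ≤ M.relNoise j n := div_nonneg (M.noiseLevel_nonneg n) (sq_nonneg _)
  rw [sparsityRate, h3, ← Real.rpow_mul h4]
  ring_nf

/-- The selected sample eigenvalues estimate the spikes with an error that is negligible relative
to the largest spike. -/
theorem IsSample.exists_rate {M : SpikedModel mbar} (hmbar : 1 ≤ mbar) {r : ℝ} (hr0 : 0 < r)
    (hr2 : r < 2) {s : ℕ → Fin mbar → ℝ} (hs : ∀ n j, WeakLr r (s n j) (M.q n j))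
    (hGR : M.GR r) (hSP : M.SP r s) {α : ℝ} (hα : 2 * √3 < α)
    {Ω : Type*} [MeasurableSpace Ω] {P : Measure Ω} [IsProbabilityMeasure P]
    {X : (n : ℕ) → Fin n → Ω → EuclideanSpace ℝ (Fin (M.p n))} (hX : M.IsSample P X) :
    ∃ R : ℕ → ℝ, Tendsto R atTop (𝓝 0) ∧ ∀ᵐ ω ∂P, ∀ᶠ n in atTop, ∀ j, 1 ≤ j → j ≤ mbar + 1 →
      |ellB α (X n · ω) j - 1 - M.spike n j| ≤ R n * M.spike n 1 := by
  set d : ℝ := 2 * √3 with hd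
  have hd0 : 0 < d := by positivity
  have hα0 : 0 < α := hd0.trans hα
  set η : ℕ → ℝ := fun n => ∑ j,
    ((2 * (α + d)) ^ (1 - r / 2) * (1 + 1 / (2 / r - 1)) * M.sparsityRate r s j n +
        2 * (α + d) * M.relNoise j n) with hη
  set c : ℝ := ((α - d) / (2 * mbar)) ^ (-r / 2) with hc
  have hτ := hGR.tendsto_noiseLevel
  have hη0 : Tendsto η atTop (𝓝 0) := by
    have : Tendsto η atTop (𝓝 (∑ j : Fin mbar,
        ((2 * (α + d)) ^ (1 - r / 2) * (1 + 1 / (2 / r - 1)) * 0 + 2 * (α + d) * 0))) :=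
      tendsto_finsetSum _ fun j _ =>
        ((hSP.tendsto_sparsityRate j).const_mul _).add ((hGR.tendsto_relNoise j).const_mul _)
    simpa using this
  have hρ0 : Tendsto (fun n => ∑ j, M.sparsityRate r s j n) atTop (𝓝 0) := by
    have := tendsto_finsetSum (Finset.univ : Finset (Fin mbar))
      fun j _ => hSP.tendsto_sparsityRate j
    simpa using this
  refine ⟨fun n => mbar * η n + (8 * (c * ∑ j, M.sparsityRate r s j n) +
    8 * mbar * M.noiseLevel n), ?_, ?_⟩
  · have := (hη0.const_mul (mbar : ℝ)).add (((hρ0.const_mul c).const_mul 8).add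
      (hτ.const_mul (8 * (mbar : ℝ))))
    simpa using this
  filter_upwards [hX.ae_eventually_diag hτ, hX.ae_eventually_entry hτ] with ω h1 h2
  have h3 : ∀ᶠ n in atTop, M.noiseLevel n < 1 / (2 * d) := hτ.eventually_lt_const (by positivity)
  have h4 : ∀ᶠ n in atTop, mbar * η n < 1 := by
    have := hη0.const_mul (mbar : ℝ)
    rw [mul_zero] at this
    exact this.eventually_lt_const one_pos
  filter_upwards [h1, h2, h3, h4, eventually_ge_atTop 2] with n hdiag hent hsmall hη1 hn j hj hj'
  have hdτ : d * M.noiseLevel n ≤ 1 / 2 := by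
    rw [lt_div_iff₀ (by positivity)] at hsmall; linarith
  have hs0 : ∀ j, 0 < s n j := fun j => one_pos.trans_le (hSP.one_le n j)
  have hmass := M.sum_sq_notMem_selected_le hr0 hr2 hs hn hs0 hα0 hd0.le hdτ hdiag
  have hnn : ∀ i : Fin mbar, 0 ≤ (2 * (α + d)) ^ (1 - r / 2) * (1 + 1 / (2 / r - 1)) *
      M.sparsityRate r s i n + 2 * (α + d) * M.relNoise i n := fun i =>
    (Finset.sum_nonneg fun ν _ => sq_nonneg _).trans (hmass i)
  have hη' : ∀ i, ∑ ν ∈ (selected α (X n · ω))ᶜ, M.q n i ν ^ 2 ≤ η n := fun i =>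
    (hmass i).trans (Finset.single_le_sum (f := fun i : Fin mbar =>
      (2 * (α + d)) ^ (1 - r / 2) * (1 + 1 / (2 / r - 1)) * M.sparsityRate r s i n +
        2 * (α + d) * M.relNoise i n) (fun i _ => hnn i) (Finset.mem_univ i))
  have hηn : 0 ≤ η n := Finset.sum_nonneg fun i _ => hnn i
  have hcard := M.card_selected_mul_noiseLevel_le hmbar hr0 hs hn (fun j => (hs0 j).le) hα
    (by linarith) hdiag
  have hmain := M.abs_ellB_sub_le (X n · ω) (mul_nonneg (by norm_num) (M.noiseLevel_nonneg n))
    hent hηn hη1 hη' hj hj'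
  refine hmain.trans ?_
  have h5 := mul_le_mul_of_nonneg_left (M.spike_anti n le_rfl hj)
    (mul_nonneg (Nat.cast_nonneg mbar) hηn)
  linarith

/-! ### Ratios of spacings -/

lemma tendsto_div_one_of_abs_sub_le {a b R : ℕ → ℝ} {K : ℝ}
    (hR : Tendsto R atTop (𝓝 0)) (hb : ∀ᶠ n in atTop, 0 < b n)
    (h : ∀ᶠ n in atTop, |a n - b n| ≤ K * R n * b n) :
    Tendsto (fun n => a n / b n) atTop (𝓝 1) := by
  rw [tendsto_iff_dist_tendsto_zero]
  have hKR := hR.const_mul K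
  rw [mul_zero] at hKR
  refine squeeze_zero' (Eventually.of_forall fun n => dist_nonneg) ?_ hKR
  filter_upwards [hb, h] with n hbn hn
  rw [Real.dist_eq, div_sub_one hbn.ne', abs_div, abs_of_pos hbn, div_le_iff₀ hbn]
  exact hn

end SpikedModel

end SparsePCA

theorem corollary3 {mbar : ℕ} (hmbar : 1 ≤ mbar) (M : SparsePCA.SpikedModel mbar)
    (r : ℝ) (hr0 : 0 < r) (hr2 : r < 2) (s : ℕ → Fin mbar → ℝ)
    (hs : ∀ n j, SparsePCA.WeakLr r (s n j) (M.q n j))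
    (hGR : M.GR r) (hSP : M.SP r s)
    (α : ℝ) (hα : 2 * Real.sqrt 3 < α)
    {Ω : Type*} [MeasurableSpace Ω] (P : Measure Ω) [IsProbabilityMeasure P]
    (X : (n : ℕ) → Fin n → Ω → EuclideanSpace ℝ (Fin (M.p n)))
    (hX : M.IsSample P X) :
    (∀ j, 1 ≤ j → j ≤ mbar →
      ((∃ L : ℝ≥0∞, L < ⊤ ∧ Tendsto (M.spikeRatio j) atTop (𝓝 L)) →
        ∀ᵐ ω ∂P, Tendsto (fun n =>
          ((SparsePCA.ellB α (X n · ω) 1 - 1) /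
            (SparsePCA.ellB α (X n · ω) j - SparsePCA.ellB α (X n · ω) (j + 1))) /
          (M.spike n 1 / (M.spike n j - M.spike n (j + 1)))) atTop (𝓝 1)) ∧
      (¬ (∃ L : ℝ≥0∞, L < ⊤ ∧ Tendsto (M.spikeRatio j) atTop (𝓝 L)) →
        (∀ᵐ ω ∂P, Tendsto (fun n =>
          ENNReal.ofReal (SparsePCA.ellB α (X n · ω) 1 - 1) /
            ENNReal.ofReal (SparsePCA.ellB α (X n · ω) j - SparsePCA.ellB α (X n · ω) (j + 1)))
          atTop (𝓝 ⊤)) ∧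
        Tendsto (M.spikeRatio j) atTop (𝓝 ⊤))) ∧
    (∀ (m : ℕ) (κ : ℝ), 1 ≤ m → m ≤ mbar → 0 < κ → M.AD m κ →
      ∀ j, 1 ≤ j → j ≤ m →
        ∀ᵐ ω ∂P, Tendsto (fun n => (SparsePCA.ellB α (X n · ω) j - 1) / M.spike n j)
          atTop (𝓝 1)) := by
  obtain ⟨R, hR, hae⟩ := hX.exists_rate hmbar hr0 hr2 hs hGR hSP hα
  have hsp1 : ∀ n, 0 < M.spike n 1 := fun n => M.spike_pos n le_rfl hmbar
  refine ⟨fun j hj hjm => ⟨?_, ?_⟩, ?_⟩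
  · rintro ⟨L, hL, hlim⟩
    -- the spacing is eventually at least `λ₁² / K` for some finite `K`
    obtain ⟨K, hK0, hLK⟩ : ∃ K : ℝ, 0 < K ∧ L < ENNReal.ofReal K := by
      refine ⟨L.toReal + 1, by positivity, ?_⟩
      rw [ENNReal.lt_ofReal_iff_toReal_lt hL.ne]
      linarith
    have hd : ∀ᶠ n in atTop, M.spike n 1 ≤ K * (M.spike n j - M.spike n (j + 1)) := by
      filter_upwards [hlim.eventually_lt_const hLK] with n hn
      rw [SparsePCA.SpikedModel.spikeRatio] at hn
      have h1 : ENNReal.ofReal (M.spike n 1) ≤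
          ENNReal.ofReal K * ENNReal.ofReal (M.spike n j - M.spike n (j + 1)) :=
        (ENNReal.div_le_iff_le_mul (Or.inr ENNReal.ofReal_ne_top)
          (Or.inr (ENNReal.ofReal_pos.2 hK0).ne')).1 hn.le
      rw [← ENNReal.ofReal_mul hK0.le] at h1
      exact (ENNReal.ofReal_le_ofReal_iff' .. |>.1 h1).resolve_right (not_le.2 (hsp1 n))
    have hdpos : ∀ᶠ n in atTop, 0 < M.spike n j - M.spike n (j + 1) := by
      filter_upwards [hd] with n hn
      exact pos_of_mul_pos_right ((hsp1 n).trans_le hn) hK0.le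
    have hR0 : ∀ᵐ ω ∂P, ∀ᶠ n in atTop, 0 ≤ R n := by
      filter_upwards [hae] with ω hω
      filter_upwards [hω] with n hn
      exact nonneg_of_mul_nonneg_left ((abs_nonneg _).trans (hn 1 le_rfl (by omega))) (hsp1 n)
    filter_upwards [hae, hR0] with ω hω hRω
    have h1 : Tendsto (fun n => (SparsePCA.ellB α (X n · ω) 1 - 1) / M.spike n 1) atTop (𝓝 1) := by
      refine SparsePCA.SpikedModel.tendsto_div_one_of_abs_sub_le (K := 1) hR
        (Eventually.of_forall hsp1) ?_
      filter_upwards [hω] with n hn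
      rw [one_mul]; exact hn 1 le_rfl (by omega)
    have h2 : Tendsto (fun n => (SparsePCA.ellB α (X n · ω) j - SparsePCA.ellB α (X n · ω) (j + 1)) /
        (M.spike n j - M.spike n (j + 1))) atTop (𝓝 1) := by
      refine SparsePCA.SpikedModel.tendsto_div_one_of_abs_sub_le (K := 2 * K) hR hdpos ?_
      filter_upwards [hω, hd, hRω] with n hn hdn hRn
      have a1 := abs_le.1 (hn j hj (by omega))
      have a2 := abs_le.1 (hn (j + 1) (by omega) (by omega))
      have a3 := mul_le_mul_of_nonneg_left hdn hRn
      rw [abs_le]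
      constructor <;> linarith [a1.1, a1.2, a2.1, a2.2]
    have h3 := h1.div h2 one_ne_zero
    rw [div_one] at h3
    refine h3.congr fun n => ?_
    simp only [Pi.div_apply]
    rw [div_div_div_comm]
  · intro hno
    obtain ⟨L, -, hlim⟩ := hGR.limit j hj hjm
    have hLtop : L = ⊤ := by
      by_contra h
      exact hno ⟨L, lt_top_iff_ne_top.2 h, hlim⟩
    rw [hLtop] at hlim
    refine ⟨?_, hlim⟩
    filter_upwards [hae] with ω hω
    rw [ENNReal.tendsto_nhds_top_iff_nat]
    intro k
    have hR1 : ∀ᶠ n in atTop, R n < 1 / (4 * (k + 1)) := hR.eventually_lt_const (by positivity)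
    have hlim1 : ∀ᶠ n in atTop, ENNReal.ofReal (4 * (k + 1)) < M.spikeRatio j n :=
      hlim.eventually_const_lt ENNReal.ofReal_lt_top
    filter_upwards [hω, hR1, hlim1] with n hn hRn hlimn
    have hsp := hsp1 n
    -- the population spacing is at most `λ₁² / (4 (k + 1))`
    have hd : 4 * (k + 1) * (M.spike n j - M.spike n (j + 1)) ≤ M.spike n 1 := by
      have h1 := ENNReal.mul_le_of_le_div hlimn.le
      rw [← ENNReal.ofReal_mul (by positivity)] at h1
      exact (ENNReal.ofReal_le_ofReal_iff hsp.le).1 h1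
    have hRs : 4 * (k + 1) * (R n * M.spike n 1) ≤ M.spike n 1 := by
      rw [lt_div_iff₀ (by positivity)] at hRn
      nlinarith
    have a0 := abs_le.1 (hn 1 le_rfl (by omega))
    have a1 := abs_le.1 (hn j hj (by omega))
    have a2 := abs_le.1 (hn (j + 1) (by omega) (by omega))
    set e := R n * M.spike n 1
    have he0 : 0 ≤ e := by linarith [a0.1, a0.2]
    have hk0 : (0 : ℝ) ≤ k := Nat.cast_nonneg k
    have hke : 0 ≤ k * e := mul_nonneg hk0 he0
    set D := SparsePCA.ellB α (X n · ω) j - SparsePCA.ellB α (X n · ω) (j + 1) with hD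
    have hDle : D ≤ M.spike n j - M.spike n (j + 1) + 2 * e := by linarith [a1.1, a1.2, a2.1, a2.2]
    have hA : 0 < SparsePCA.ellB α (X n · ω) 1 - 1 := by nlinarith [a0.1]
    have hdn : 0 ≤ M.spike n j - M.spike n (j + 1) := by linarith [M.spike_anti n hj (Nat.le_succ j)]
    have hkD : k * D < SparsePCA.ellB α (X n · ω) 1 - 1 := by
      have := mul_le_mul_of_nonneg_left hDle hk0
      nlinarith [a0.1]
    rw [ENNReal.lt_div_iff_mul_lt (Or.inr (ENNReal.natCast_ne_top k))
      (Or.inl ENNReal.ofReal_ne_top), ← ENNReal.ofReal_natCast,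
      ← ENNReal.ofReal_mul hk0]
    exact (ENNReal.ofReal_lt_ofReal_iff hA).2 hkD
  · intro m κ hm hmm hκ hAD j hj hjm
    filter_upwards [hae] with ω hω
    refine SparsePCA.SpikedModel.tendsto_div_one_of_abs_sub_le (K := κ) hR
      (Eventually.of_forall fun n => M.spike_pos n hj (hjm.trans hmm)) ?_
    filter_upwards [hω, hAD] with n hn hADn
    have h1 := hn j hj (by omega)
    have hRn : 0 ≤ R n :=
      nonneg_of_mul_nonneg_left ((abs_nonneg _).trans h1) (hsp1 n)
    have h2 : M.spike n 1 ≤ κ * M.spike n j := by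
      rw [div_le_iff₀ hκ] at hADn
      have h3 := M.spike_nonneg n (m + 1)
      have h4 := M.spike_anti n hj hjm
      nlinarith
    calc _ ≤ R n * M.spike n 1 := h1
      _ ≤ R n * (κ * M.spike n j) := by gcongr
      _ = _ := by ring
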